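/- **Model.** Let $(X_t)_{t\in\mathbb Z}$ be an $\mathbb R^p$-valued $\lambda$-GARCH process: $X_t=V_0\,\mathrm{diag}(\lambda_t)^{1/2}Z_t$ and $\lambda_t=W_0+A_0(V_0'X_{t-1})^{\odot 2}+B_0\lambda_{t-1}$, where $V_0$ is orthogonal, $A_0$ and the diagonal matrix $B_0=\mathrm{diag}(b_0)$ have non-negative entries, the entries of the unconditional eigenvalues $\lambda_0$ and of the intercept $W_0=(I_p-A_0-B_0)\lambda_0$ are positive, and the entries of $\lambda_t$ are positive. The $Z_t$ are iid with mean $0$ and covariance $I_p$. With respect to some filtration $(\mathcal F_t)_{t\in\mathbb Z}$, $Z_t$ is $\mathcal F_t$-measurable and independent of $\mathcal F_{t-1}$, and $\lambda_t$ is $\mathcal F_{t-1}$-measurable. Write $\gamma=(\lambda,V)$, with $V_j$ the columns of $V$, and $\kappa^{(i)}=(a_{i1},\dots,a_{ip},b_i)$, $\theta^{(i)}=(\gamma,\kappa^{(i)})$, $y_{j,t}(\gamma)=V_j'X_t$ and $w_i(\lambda,\kappa^{(i)})=(1-b_i)\lambda_i-\sum_j a_{ij}\lambda_j$; a subscript $0$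 marks true values. **Normalization.** For each $j$ fix a sign rule, that is, a set $S_j\subset\mathbb R^p$ containing exactly one of $v,-v$ for every $v\neq0$ (for instance: the first non-zero entry is positive). The entries of $\lambda_0$ are in non-decreasing order, and $V_{0,j}$ lies in the interior of $S_j$ (in the example, for $p\ge 2$: the first entry of $V_{0,j}$ is positive). **Estimator.** First step: $\hat\gamma_T=(\hat\lambda_T,\hat V_T)$ is a spectral decomposition of the sample covariance matrix $\hat H_T=\frac1T\sum_{t=1}^T X_tX_t'$, with orthonormal eigenvectors, eigenvalues in non-decreasing order, and the $j$-th eigenvector in $S_j$. Second step, for equation $i$: $\hat\kappa_T^{(i)}\in\mathcal K^{(i)}$ minimizes over $\mathcal K^{(i)}$, whenever a minimizer exists, the Gaussian quasi-likelihood $$\kappa\mapsto\frac1T\sum_{t=1}^T\Big(\log\lambda_{i,t,h}(\hat\gamma_T,\kappa)+\frac{y_{i,t}^2(\hat\gamma_T)}{\lambda_{i,t,h}(\hat\gamma_T,\kappa)}\Big),$$ where $\lambda_{i,t,h}(\gamma,\kappa)=w_i+\sum_j a_{ij}y_{j,t-1}^2(\gamma)+b_i\lambda_{i,t-1,h}(\gamma,\kappa)$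 for $t\ge1$ is initiated in $\lambda_{i,0,h}=V_i'H_hV_i$, with $H_h$ a fixed positive definite matrix and with an arbitrary (fixed or random) initial value in place of $X_0$. **Assumptions.** (1) $(X_t)$ is strictly stationary, ergodic and has finite second moments. (2) All eigenvalues of the unconditional covariance matrix $H=E[X_tX_t']$ have algebraic multiplicity one. (3) $\theta_0^{(i)}\in\Theta^{(i)}=\mathcal L\times\mathcal V\times\mathcal K^{(i)}$, where $\Theta^{(i)}$ is compact, $\lambda$ has positive entries for $\lambda\in\mathcal L$, each $V\in\mathcal V$ is orthogonal, $a_{ij}\ge0$ and $b_i\ge0$ on $\mathcal K^{(i)}$, and $w_i(\lambda,\kappa)>0$ on $\mathcal L\times\mathcal K^{(i)}$. (4) For every $t$ and every $\kappa\in\mathcal K^{(i)}$ with $\kappa\ne\kappa^{(i)}_0$, it is not the case that $\lambda_{i,t}(\gamma_0,\kappa)=\lambda_{i,t}(\gamma_0,\kappa_0^{(i)})$ almost surely, where $\lambda_{i,t}(\gamma,\kappa)=\sum_{n\ge0}b_i^n\big(w_i+\sum_j a_{ij}y_{j,t-1-n}^2(\gamma)\big)$ is the conditional eigenvalue initiated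 in the infinite past. **Theorem.** Under these assumptions, for each $i=1,\dots,p$, as $T\to\infty$, $$\hat\theta^{(i)}_T=(\hat\lambda_T,\hat V_T,\hat\kappa^{(i)}_T)\longrightarrow\theta^{(i)}_0=(\lambda_0,V_0,\kappa^{(i)}_0)\qquad\text{almost surely.}$$ -/

import Mathlib

open MeasureTheory ProbabilityTheory Filter Topology
open scoped Matrix

namespace LambdaGARCH

/-- Vectors of returns, eigenvalues, and so on. -/
abbrev Vec (p : ℕ) := Fin p → ℝ

/-- Static parameters `γ = (λ, V)`: the unconditional eigenvalues and the matrix whose columns are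
the eigenvectors. -/
abbrev Static (p : ℕ) := Vec p × Matrix (Fin p) (Fin p) ℝ

/-- Dynamic parameters `κ = (a₁, …, a_p, b)` of one equation. -/
abbrev Dynamic (p : ℕ) := Vec p × ℝ

/-- Rotated returns `y = V' x`. -/
def rotated {p : ℕ} (V : Matrix (Fin p) (Fin p) ℝ) (x : Vec p) : Vec p := Vᵀ *ᵥ x

/-- The targeted intercept `wᵢ = (1 - b) λᵢ - ∑ⱼ aⱼ λⱼ`. -/
def intercept {p : ℕ} (i : Fin p) (l : Vec p) (κ : Dynamic p) : ℝ :=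
  (1 - κ.2) * l i - ∑ j, κ.1 j * l j

/-- `X` is a (covariance targeting) `λ`-GARCH process with innovations `Z`, conditional eigenvalues
`lam`, information flow `ℱ`, and true parameters `l₀` (unconditional eigenvalues),
`V₀` (orthonormal eigenvectors), `A₀`, and `B₀ = diag b₀`. The innovations are iid with mean `0` and
covariance `I`: mutual independence is the combination of `Z_adapted` and `Z_indep`. -/
structure IsLambdaGARCH {p : ℕ} {Ω : Type*} [mΩ : MeasurableSpace Ω] (P : Measure Ω)
    (ℱ : Filtration ℤ mΩ) (l₀ : Vec p) (V₀ A₀ : Matrix (Fin p) (Fin p) ℝ) (b₀ : Vec p)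
    (Z X lam : ℤ → Ω → Vec p) : Prop where
  eigenvalue_pos : ∀ j, 0 < l₀ j
  orthogonal : V₀ ∈ Matrix.orthogonalGroup (Fin p) ℝ
  A_nonneg : ∀ j k, 0 ≤ A₀ j k
  b_nonneg : ∀ j, 0 ≤ b₀ j
  intercept_pos : ∀ j, 0 < intercept j l₀ (A₀ j, b₀ j)
  Z_adapted : ∀ t, Measurable[ℱ t] (Z t)
  Z_indep : ∀ t, Indep (MeasurableSpace.comap (Z t) inferInstance) (ℱ (t - 1)) P
  Z_identDistrib : ∀ s t, IdentDistrib (Z s) (Z t) P P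
  Z_memLp : ∀ t j, MemLp (fun ω => Z t ω j) 2 P
  Z_mean : ∀ t j, ∫ ω, Z t ω j ∂P = 0
  Z_cov : ∀ t j k, ∫ ω, Z t ω j * Z t ω k ∂P = if j = k then 1 else 0
  lam_predictable : ∀ t, Measurable[ℱ (t - 1)] (lam t)
  lam_pos : ∀ᵐ ω ∂P, ∀ t j, 0 < lam t ω j
  lam_eq : ∀ᵐ ω ∂P, ∀ t j, lam t ω j = intercept j l₀ (A₀ j, b₀ j)
    + ∑ k, A₀ j k * rotated V₀ (X (t - 1) ω) k ^ 2 + b₀ j * lam (t - 1) ω j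
  X_measurable : ∀ t, Measurable (X t)
  X_eq : ∀ᵐ ω ∂P, ∀ t, X t ω = V₀ *ᵥ fun j => √(lam t ω j) * Z t ω j

/-- Strict stationarity and ergodicity of a two-sided process: the shift on the space of paths
preserves the law of the process and is ergodic for it. -/
def IsStationaryErgodic {Ω E : Type*} [MeasurableSpace Ω] [MeasurableSpace E] (P : Measure Ω)
    (X : ℤ → Ω → E) : Prop :=
  Ergodic (fun (x : ℤ → E) (t : ℤ) => x (t + 1)) (P.map fun ω t => X t ω)

/-- The unconditional covariance matrix `H = E[X₀ X₀']` of a centered stationary process. -/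
noncomputable def uncondCov {p : ℕ} {Ω : Type*} [MeasurableSpace Ω] (P : Measure Ω)
    (X : ℤ → Ω → Vec p) : Matrix (Fin p) (Fin p) ℝ :=
  Matrix.of fun j k => ∫ ω, X 0 ω j * X 0 ω k ∂P

/-- All eigenvalues have algebraic multiplicity one. -/
def HasSimpleEigenvalues {p : ℕ} (H : Matrix (Fin p) (Fin p) ℝ) : Prop :=
  ∀ x : ℝ, H.charpoly.IsRoot x → H.charpoly.rootMultiplicity x = 1

/-- The restrictions on the parameter space `Θ⁽ⁱ⁾ = 𝓛 × 𝓥 × 𝓚⁽ⁱ⁾` of equation `i`. -/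
structure IsParameterSpace {p : ℕ} (i : Fin p) (L : Set (Vec p))
    (V : Set (Matrix (Fin p) (Fin p) ℝ)) (K : Set (Dynamic p)) : Prop where
  isCompact : IsCompact (L ×ˢ V ×ˢ K)
  eigenvalue_pos : ∀ l ∈ L, ∀ j, 0 < l j
  orthogonal : ∀ v ∈ V, v ∈ Matrix.orthogonalGroup (Fin p) ℝ
  a_nonneg : ∀ κ ∈ K, ∀ j, 0 ≤ κ.1 j
  b_nonneg : ∀ κ ∈ K, 0 ≤ κ.2
  intercept_pos : ∀ l ∈ L, ∀ κ ∈ K, 0 < intercept i l κ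

/-- The conditional eigenvalue `λ_{i,t}(γ, κ)` initiated in the infinite past, i.e. the stationary
solution of `λ_{i,t} = wᵢ + ∑ⱼ aⱼ y_{j,t-1}² + b λ_{i,t-1}`. -/
noncomputable def eigInf {p : ℕ} {Ω : Type*} (X : ℤ → Ω → Vec p) (i : Fin p) (γ : Static p)
    (κ : Dynamic p) (t : ℤ) (ω : Ω) : ℝ :=
  ∑' n : ℕ, κ.2 ^ n *
    (intercept i γ.1 κ + ∑ j, κ.1 j * rotated γ.2 (X (t - 1 - (n : ℤ)) ω) j ^ 2)

/-- The conditional eigenvalue `λ_{i,t}(γ, κ)`, `t = 0, 1, …`, computed from observations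
`x₀, x₁, …` and initiated in a fixed `H₀`, that is in `λ_{i,0} = Vᵢ' H₀ Vᵢ`. -/
def eigFilter {p : ℕ} (i : Fin p) (H₀ : Matrix (Fin p) (Fin p) ℝ) (x : ℕ → Vec p) (γ : Static p)
    (κ : Dynamic p) : ℕ → ℝ
  | 0 => γ.2ᵀ i ⬝ᵥ (H₀ *ᵥ γ.2ᵀ i)
  | t + 1 => intercept i γ.1 κ + ∑ j, κ.1 j * rotated γ.2 (x t) j ^ 2
      + κ.2 * eigFilter i H₀ x γ κ t

/-- The Gaussian quasi-likelihood (with the sign for minimization) of equation `i`,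
`T⁻¹ ∑_{t=1}^T (log λ_{i,t} + y_{i,t}² / λ_{i,t})`. -/
noncomputable def quasiLik {p : ℕ} (i : Fin p) (H₀ : Matrix (Fin p) (Fin p) ℝ) (x : ℕ → Vec p)
    (T : ℕ) (γ : Static p) (κ : Dynamic p) : ℝ :=
  (T : ℝ)⁻¹ * ∑ t ∈ Finset.Icc 1 T,
    (Real.log (eigFilter i H₀ x γ κ t) + rotated γ.2 (x t) i ^ 2 / eigFilter i H₀ x γ κ t)

/-- The sample `X₁, X₂, …` preceded by an initial value `x₀`. -/
def sample {p : ℕ} {Ω : Type*} (x₀ : Ω → Vec p) (X : ℤ → Ω → Vec p) (ω : Ω) : ℕ → Vec p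
  | 0 => x₀ ω
  | t + 1 => X ((t : ℤ) + 1) ω

/-- The sample covariance matrix `T⁻¹ ∑_{t=1}^T X_t X_t'`. -/
noncomputable def sampleCov {p : ℕ} {Ω : Type*} (X : ℤ → Ω → Vec p) (T : ℕ) (ω : Ω) :
    Matrix (Fin p) (Fin p) ℝ :=
  (T : ℝ)⁻¹ • ∑ t ∈ Finset.Icc 1 T, Matrix.vecMulVec (X (t : ℤ) ω) (X (t : ℤ) ω)

/-- A sign normalization of vectors, for instance "the first non-zero entry is positive": a set that
contains exactly one of `v` and `-v` for each `v ≠ 0`. -/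
def IsSignRule {p : ℕ} (S : Set (Vec p)) : Prop :=
  ∀ v : Vec p, v ≠ 0 → Xor (v ∈ S) (-v ∈ S)

/-- `γ = (λ, V)` is a normalized spectral decomposition of `H`: orthonormal eigenvectors (the columns
of `V`), eigenvalues in non-decreasing order, and the sign of the `j`-th eigenvector fixed by
the rule `S j`. -/
structure IsSpectralDecomp {p : ℕ} (S : Fin p → Set (Vec p)) (H : Matrix (Fin p) (Fin p) ℝ)
    (γ : Static p) : Prop where
  orthogonal : γ.2 ∈ Matrix.orthogonalGroup (Fin p) ℝ
  eigen : ∀ j, H *ᵥ γ.2ᵀ j = γ.1 j • γ.2ᵀ j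
  monotone : Monotone γ.1
  sign : ∀ j, γ.2ᵀ j ∈ S j

/-- `κ ∈ K` is a minimizer of `f` over `K`, as soon as there is one. -/
def IsArgmin {α : Type*} (K : Set α) (f : α → ℝ) (κ : α) : Prop :=
  κ ∈ K ∧ ((∃ κ' ∈ K, IsMinOn f K κ') → IsMinOn f K κ)

end LambdaGARCH

open LambdaGARCH

/-! The first step is a continuity argument. Squared innovations are independent of predictable
factors, so the mean of `lam` solves a linear fixed-point equation. Positivity of the intercepts
says that the nonnegative matrix `A₀ + diag b₀` strictly contracts the `l₀`-weighted sup norm, hence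
`l₀` is the only solution (`integral_lam`) and the covariance matrix is `V₀ * diagonal l₀ * V₀ᵀ`
(`uncondCov_eq`). The ergodic theorem, proved here from a maximal inequality, gives convergence of
the sample covariance matrix. Normalized spectral decompositions are continuous at a matrix with
simple eigenvalues (`tendsto_of_isSpectralDecomp`).

The second step is Wald's argument. At the true static parameters, conditioning on the past turns
the expected loss into the mean of `log s + lam / s`, which is smallest exactly when `s = lam`;
identification then makes the minimizer unique (`integral_lossPath_lt`). A locally uniform law of
large numbers (`exists_ae_eventually_abs_quasiLik_sub_lt`) covers a whole neighbourhood of static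
and dynamic parameters and any initial values, so the first-step estimate may be plugged in.
Countably many small balls cover the wrong parameters in `K`; almost surely the minimizer leaves
each of them, and compactness yields convergence.

The delicate point is that only second moments are available: a squared return times an error in the
conditional eigenvalue need not be integrable. Since eigenvalues are bounded below by `c`, the error
in their reciprocals is at most `1 / c`, and the truncated modulus `lossModulus` is controlled by
dominated convergence. -/

namespace LambdaGARCH

/-! ### The pointwise ergodic theorem. -/

section Birkhoff

variable {α : Type*} {T : α → α} {f : α → ℝ}

/-- The running maximum of the Birkhoff sums of `f`, starting with the empty sum. -/
noncomputable def birkhoffMax (T : α → α) (f : α → ℝ) : ℕ → α → ℝ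
  | 0 => fun _ => 0
  | n + 1 => fun x => max 0 (f x + birkhoffMax T f n (T x))

lemma birkhoffMax_nonneg (n : ℕ) (x : α) : 0 ≤ birkhoffMax T f n x := by
  cases n with
  | zero => exact le_rfl
  | succ n => exact le_max_left _ _

lemma birkhoffMax_le_succ (n : ℕ) (x : α) : birkhoffMax T f n x ≤ birkhoffMax T f (n + 1) x := by
  induction n generalizing x with
  | zero => exact birkhoffMax_nonneg _ _
  | succ n ih => exact max_le_max le_rfl (add_le_add le_rfl (ih (T x)))

lemma birkhoffSum_le_birkhoffMax (n : ℕ) (x : α) : birkhoffSum T f n x ≤ birkhoffMax T f n x := by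
  induction n generalizing x with
  | zero => simp [birkhoffMax]
  | succ n ih =>
    rw [birkhoffSum_succ']
    exact (add_le_add le_rfl (ih (T x))).trans (le_max_right _ _)

variable [MeasurableSpace α] {μ : Measure α}

lemma integrable_birkhoffMax (hT : MeasurePreserving T μ μ) (hf : Integrable f μ) (n : ℕ) :
    Integrable (birkhoffMax T f n) μ := by
  induction n with
  | zero => exact integrable_zero _ _ _
  | succ n ih => exact (integrable_zero _ _ _).sup (hf.add (hT.integrable_comp_of_integrable ih))

/-- If almost everywhere some Birkhoff sum of `f` is positive, then `0 ≤ ∫ f`. -/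
lemma integral_nonneg_of_exists_birkhoffSum_pos (hT : MeasurePreserving T μ μ)
    (hf : Integrable f μ)
    (h : ∀ᵐ x ∂μ, ∃ n, 0 < birkhoffSum T f n x) : 0 ≤ ∫ x, f x ∂μ := by
  have hM := integrable_birkhoffMax hT hf
  have hMT : ∀ n, Integrable (fun x => birkhoffMax T f n (T x)) μ := fun n =>
    hT.integrable_comp_of_integrable (hM n)
  -- The integrand is the increment `M (n+1) - M n ∘ T` of the running maximum. By invariance of `μ`
  -- its integral is that of `M (n+1) - M n`, which is nonnegative.
  have key : ∀ n, 0 ≤ ∫ x, max (-birkhoffMax T f n (T x)) (f x) ∂μ := by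
    intro n
    have h1 : (fun x => max (-birkhoffMax T f n (T x)) (f x)) =
        fun x => birkhoffMax T f (n + 1) x - birkhoffMax T f n (T x) := by
      funext x
      simp only [birkhoffMax]
      rcases le_total (-birkhoffMax T f n (T x)) (f x) with h | h
      · rw [max_eq_right h, max_eq_right (by linarith)]; ring
      · rw [max_eq_left h, max_eq_left (by linarith)]; ring
    rw [h1, integral_sub (hM _) (hMT n)]
    have h2 : ∫ x, birkhoffMax T f n (T x) ∂μ = ∫ x, birkhoffMax T f n x ∂μ := by
      conv_rhs => rw [← hT.map_eq]
      rw [integral_map hT.measurable.aemeasurable]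
      rw [hT.map_eq]; exact (hM n).aestronglyMeasurable
    rw [h2, ← integral_sub (hM _) (hM n)]
    exact integral_nonneg fun x => sub_nonneg.2 (birkhoffMax_le_succ n x)
  -- Once some Birkhoff sum at `x` is positive, `f x + M n (T x)` is positive for all large `n`, so
  -- the integrand is eventually equal to `f x`; it is always dominated by `|f|`.
  have lim : Tendsto (fun n => ∫ x, max (-birkhoffMax T f n (T x)) (f x) ∂μ) atTop
      (𝓝 (∫ x, f x ∂μ)) := by
    refine tendsto_integral_of_dominated_convergence (fun x => |f x|)
      (fun n => ((hMT n).neg.sup hf).aestronglyMeasurable) hf.abs ?_ ?_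
    · intro n
      refine Eventually.of_forall fun x => ?_
      have := birkhoffMax_nonneg (T := T) (f := f) n (T x)
      rw [Real.norm_eq_abs]
      refine abs_le.2 ⟨?_, ?_⟩
      · exact (neg_abs_le _).trans (le_max_right _ _)
      · exact max_le (by linarith [abs_nonneg (f x)]) (le_abs_self _)
    · filter_upwards [h] with x hx
      obtain ⟨n, hn⟩ := hx
      obtain _ | m := n
      · simp at hn
      rw [birkhoffSum_succ'] at hn
      refine tendsto_const_nhds.congr' ?_
      filter_upwards [eventually_ge_atTop m] with n hmn
      have h1 := birkhoffSum_le_birkhoffMax (T := T) (f := f) m (T x)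
      have h2 : birkhoffMax T f m (T x) ≤ birkhoffMax T f n (T x) :=
        monotone_nat_of_le_succ (fun n => birkhoffMax_le_succ n (T x)) hmn
      rw [max_eq_right (by linarith)]
  exact ge_of_tendsto' lim key

lemma measurable_birkhoffSum (hT : Measurable T) (hf : Measurable f) (n : ℕ) :
    Measurable (birkhoffSum T f n) :=
  Finset.measurable_sum _ fun k _ => hf.comp (hT.iterate k)

/-- The upper half of the pointwise ergodic theorem: Birkhoff sums of a function with negative
integral are bounded above. -/
lemma ae_birkhoffSum_bddAbove (hT : Ergodic T μ) (hfm : Measurable f)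
    (hf : Integrable f μ) (hneg : ∫ x, f x ∂μ < 0) :
    ∀ᵐ x ∂μ, ∃ k : ℝ, ∀ n, birkhoffSum T f n x ≤ k := by
  -- Unboundedness from above is a strictly invariant event, since passing from `x` to `T x` changes
  -- the sums only by `f x`. Ergodicity makes it null or full, and full would force a nonnegative
  -- integral.
  have hset : MeasurableSet {x | ∀ k : ℕ, ∃ n, (k : ℝ) < birkhoffSum T f n x} := by
    simp only [Set.ofPred_forall, Set.ofPred_exists]
    exact MeasurableSet.iInter fun k => MeasurableSet.iUnion fun n =>
      measurableSet_lt measurable_const (measurable_birkhoffSum hT.measurable hfm n)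
  have hinv : T ⁻¹' {x | ∀ k : ℕ, ∃ n, (k : ℝ) < birkhoffSum T f n x} =
      {x | ∀ k : ℕ, ∃ n, (k : ℝ) < birkhoffSum T f n x} := by
    ext x
    simp only [Set.mem_preimage, Set.mem_ofPred_eq]
    constructor
    · intro h k
      obtain ⟨l, hl⟩ := exists_nat_gt ((k : ℝ) - f x)
      obtain ⟨n, hn⟩ := h l
      exact ⟨n + 1, by rw [birkhoffSum_succ']; linarith⟩
    · intro h k
      obtain ⟨l, hl⟩ := exists_nat_gt ((k : ℝ) + |f x|)
      obtain ⟨n, hn⟩ := h l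
      obtain _ | n := n
      · have : (0 : ℝ) ≤ l := l.cast_nonneg
        simp at hn
        linarith
      · rw [birkhoffSum_succ'] at hn
        exact ⟨n, by linarith [le_abs_self (f x)]⟩
  rcases hT.toPreErgodic.ae_mem_or_ae_notMem hset hinv with h | h
  · refine absurd (integral_nonneg_of_exists_birkhoffSum_pos hT.toMeasurePreserving hf ?_)
      (not_le.2 hneg)
    filter_upwards [h] with x hx
    obtain ⟨n, hn⟩ := hx 0
    exact ⟨n, by simpa using hn⟩
  · filter_upwards [h] with x hx
    simp only [not_forall, not_exists, not_lt] at hx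
    obtain ⟨k, hk⟩ := hx
    exact ⟨k, hk⟩

/-- Subtracting the mean plus `ε / 2` makes the integral negative, so the centered sums stay below a
pathwise constant, whose share in the average drops below `ε / 2`. -/
lemma ae_eventually_birkhoffAverage_le [IsProbabilityMeasure μ] (hT : Ergodic T μ)
    (hfm : Measurable f) (hf : Integrable f μ) {ε : ℝ} (hε : 0 < ε) :
    ∀ᵐ x ∂μ, ∀ᶠ n : ℕ in atTop, (n : ℝ)⁻¹ * birkhoffSum T f n x ≤ ∫ x, f x ∂μ + ε := by
  have h := ae_birkhoffSum_bddAbove (f := fun x => f x - (∫ x, f x ∂μ + ε / 2)) hT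
    (hfm.sub_const _) (hf.sub (integrable_const _)) (by
      rw [integral_sub hf (integrable_const _)]
      simp [hε])
  filter_upwards [h] with x ⟨k, hk⟩
  have h0 : Tendsto (fun n : ℕ => (n : ℝ)⁻¹ * k) atTop (𝓝 0) := by
    simpa using (tendsto_inv_atTop_nhds_zero_nat (𝕜 := ℝ)).mul_const k
  filter_upwards [h0.eventually_lt_const (half_pos hε), eventually_gt_atTop 0] with n hn hn0
  have hs : birkhoffSum T (fun x => f x - (∫ x, f x ∂μ + ε / 2)) n x =
      birkhoffSum T f n x - n * (∫ x, f x ∂μ + ε / 2) := by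
    simp [birkhoffSum, Finset.sum_sub_distrib]
    ring
  have hn' : (0 : ℝ) < n := by exact_mod_cast hn0
  have h1 := hk n
  rw [hs] at h1
  have h2 : (n : ℝ)⁻¹ * birkhoffSum T f n x ≤
      (n : ℝ)⁻¹ * (k + n * (∫ x, f x ∂μ + ε / 2)) :=
    mul_le_mul_of_nonneg_left (by linarith) (inv_nonneg.2 hn'.le)
  have h3 : (n : ℝ)⁻¹ * (k + n * (∫ x, f x ∂μ + ε / 2)) =
      (n : ℝ)⁻¹ * k + (∫ x, f x ∂μ + ε / 2) := by
    rw [mul_add, inv_mul_cancel_left₀ hn'.ne']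
  linarith

/-- The pointwise ergodic theorem of Birkhoff for ergodic transformations. -/
theorem ae_tendsto_birkhoffAverage [IsProbabilityMeasure μ] (hT : Ergodic T μ)
    (hfm : Measurable f) (hf : Integrable f μ) :
    ∀ᵐ x ∂μ, Tendsto (fun n : ℕ => (n : ℝ)⁻¹ * birkhoffSum T f n x) atTop
      (𝓝 (∫ x, f x ∂μ)) := by
  have hu : ∀ᵐ x ∂μ, ∀ m : ℕ, ∀ᶠ n : ℕ in atTop,
      (n : ℝ)⁻¹ * birkhoffSum T f n x ≤ ∫ x, f x ∂μ + 1 / ((m : ℝ) + 1) :=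
    ae_all_iff.2 fun m => ae_eventually_birkhoffAverage_le hT hfm hf Nat.one_div_pos_of_nat
  -- The lower half is the upper half for `-f`.
  have hl : ∀ᵐ x ∂μ, ∀ m : ℕ, ∀ᶠ n : ℕ in atTop,
      (n : ℝ)⁻¹ * birkhoffSum T (fun x => -f x) n x ≤
        ∫ x, -f x ∂μ + 1 / ((m : ℝ) + 1) :=
    ae_all_iff.2 fun m => ae_eventually_birkhoffAverage_le hT hfm.neg hf.neg
      Nat.one_div_pos_of_nat
  filter_upwards [hu, hl] with x hxu hxl
  refine tendsto_order.2 ⟨fun a ha => ?_, fun a ha => ?_⟩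
  · obtain ⟨m, hm⟩ := exists_nat_one_div_lt (sub_pos.2 ha)
    filter_upwards [hxl m] with n hn
    rw [integral_neg] at hn
    have : birkhoffSum T (fun x => -f x) n x = -birkhoffSum T f n x := by
      simp [birkhoffSum]
    rw [this] at hn
    linarith
  · obtain ⟨m, hm⟩ := exists_nat_one_div_lt (sub_pos.2 ha)
    filter_upwards [hxu m] with n hn
    linarith

end Birkhoff

/-! ### Shifts of two-sided paths and discounted sums over the past. -/

section Past

variable {p : ℕ}

/-- The `k`-fold shift of a two-sided path. -/
def shiftBy (k : ℤ) (x : ℤ → Vec p) : ℤ → Vec p := fun t => x (t + k)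

lemma shiftBy_shiftBy (k l : ℤ) (x : ℤ → Vec p) : shiftBy k (shiftBy l x) = shiftBy (k + l) x := by
  funext t
  simp only [shiftBy, add_assoc]

lemma shiftBy_zero (x : ℤ → Vec p) : shiftBy 0 x = x := by
  funext t
  simp [shiftBy]

lemma measurable_shiftBy (k : ℤ) : Measurable (shiftBy k : (ℤ → Vec p) → ℤ → Vec p) :=
  measurable_pi_lambda _ fun t => measurable_pi_apply (t + k)

lemma iterate_shiftBy_one (n : ℕ) : (shiftBy 1 : (ℤ → Vec p) → ℤ → Vec p)^[n] = shiftBy n := by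
  induction n with
  | zero => funext x; simp [shiftBy_zero]
  | succ n ih =>
    funext x
    rw [Function.iterate_succ_apply', ih, shiftBy_shiftBy]
    congr 1
    push_cast
    ring

lemma measurePreserving_shiftBy {ν : Measure (ℤ → Vec p)}
    (hν : MeasurePreserving (shiftBy 1) ν ν) (k : ℤ) : MeasurePreserving (shiftBy k) ν ν := by
  have hnat : ∀ n : ℕ, MeasurePreserving (shiftBy (n : ℤ)) ν ν := fun n =>
    iterate_shiftBy_one (p := p) n ▸ hν.iterate n
  obtain ⟨n, rfl | rfl⟩ := k.eq_nat_or_neg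
  · exact hnat n
  · refine ⟨measurable_shiftBy _, ?_⟩
    conv_lhs => rw [← (hnat n).map_eq]
    rw [Measure.map_map (measurable_shiftBy _) (measurable_shiftBy _)]
    have : (shiftBy (-(n : ℤ)) ∘ shiftBy (n : ℤ) : (ℤ → Vec p) → ℤ → Vec p) = id := by
      funext x
      simp [shiftBy_shiftBy, shiftBy_zero]
    rw [this, Measure.map_id]

/-- The discounted sum of the past values of `g` along a path: the stationary solution `s` of
`s (shift x) = g x + β * s x`. -/
noncomputable def past (β : ℝ) (g : (ℤ → Vec p) → ℝ) (x : ℤ → Vec p) : ℝ :=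
  ∑' n : ℕ, β ^ n * g (shiftBy (-1 - (n : ℤ)) x)

variable {β : ℝ} {g : (ℤ → Vec p) → ℝ}

lemma past_nonneg (hβ : 0 ≤ β) (hg : ∀ x, 0 ≤ g x) (x : ℤ → Vec p) : 0 ≤ past β g x :=
  tsum_nonneg fun _ => mul_nonneg (pow_nonneg hβ _) (hg _)

/-- No summability is needed: a divergent series has real sum `0`, and `ENNReal.toReal` sends `⊤` to
`0`. -/
lemma past_eq_toReal (hβ : 0 ≤ β) (hg : ∀ x, 0 ≤ g x) (x : ℤ → Vec p) :
    past β g x = (∑' n : ℕ, ENNReal.ofReal (β ^ n * g (shiftBy (-1 - (n : ℤ)) x))).toReal := by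
  rw [ENNReal.tsum_toReal_eq fun _ => ENNReal.ofReal_ne_top]
  exact tsum_congr fun n => (ENNReal.toReal_ofReal (mul_nonneg (pow_nonneg hβ _) (hg _))).symm

lemma measurable_past (hgm : Measurable g) : Measurable (past β g) :=
  Measurable.tsum fun n => (hgm.comp (measurable_shiftBy _)).const_mul (β ^ n)

variable {ν : Measure (ℤ → Vec p)}

/-- By Tonelli and shift invariance the integral is a geometric series times the mean of `g`. The
shifts are arbitrary because the bound serves both backward sums (`past`) and forward sums (the
fading effect of initial values). -/
lemma lintegral_discounted_ne_top (hν : MeasurePreserving (shiftBy 1) ν ν) (hβ : 0 ≤ β)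
    (hβ1 : β < 1) (hgm : Measurable g) (hgi : Integrable g ν) (k : ℕ → ℤ) :
    ∫⁻ x, ∑' n : ℕ, ENNReal.ofReal (β ^ n * g (shiftBy (k n) x)) ∂ν ≠ ⊤ := by
  have h1 : ∀ n : ℕ, ∫⁻ x, ENNReal.ofReal (β ^ n * g (shiftBy (k n) x)) ∂ν =
      ENNReal.ofReal (β ^ n) * ∫⁻ x, ENNReal.ofReal (g x) ∂ν := by
    intro n
    simp_rw [ENNReal.ofReal_mul (pow_nonneg hβ n)]
    rw [lintegral_const_mul' _ _ ENNReal.ofReal_ne_top]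
    congr 1
    exact (measurePreserving_shiftBy hν _).lintegral_comp hgm.ennreal_ofReal
  rw [lintegral_tsum]
  · simp_rw [h1]
    rw [ENNReal.tsum_mul_right]
    exact ENNReal.mul_ne_top (summable_geometric_of_lt_one hβ hβ1).tsum_ofReal_ne_top
      hgi.lintegral_lt_top.ne
  · exact fun n => ((hgm.comp (measurable_shiftBy _)).const_mul _).ennreal_ofReal.aemeasurable

lemma ae_summable_discounted (hν : MeasurePreserving (shiftBy 1) ν ν) (hβ : 0 ≤ β) (hβ1 : β < 1)
    (hg : ∀ x, 0 ≤ g x) (hgm : Measurable g) (hgi : Integrable g ν) (k : ℕ → ℤ) :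
    ∀ᵐ x ∂ν, Summable fun n : ℕ => β ^ n * g (shiftBy (k n) x) := by
  have hm : Measurable fun x => ∑' n : ℕ, ENNReal.ofReal (β ^ n * g (shiftBy (k n) x)) :=
    Measurable.tsum fun n => ((hgm.comp (measurable_shiftBy _)).const_mul _).ennreal_ofReal
  filter_upwards [ae_lt_top hm (lintegral_discounted_ne_top hν hβ hβ1 hgm hgi k)] with x hx
  refine (ENNReal.summable_toReal hx.ne).congr fun n => ?_
  exact ENNReal.toReal_ofReal (mul_nonneg (pow_nonneg hβ _) (hg _))

lemma integrable_past (hν : MeasurePreserving (shiftBy 1) ν ν) (hβ : 0 ≤ β) (hβ1 : β < 1)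
    (hg : ∀ x, 0 ≤ g x) (hgm : Measurable g) (hgi : Integrable g ν) :
    Integrable (past β g) ν := by
  rw [funext (past_eq_toReal hβ hg)]
  have hm : Measurable fun x => ∑' n : ℕ, ENNReal.ofReal (β ^ n * g (shiftBy (-1 - (n : ℤ)) x)) :=
    Measurable.tsum fun n => ((hgm.comp (measurable_shiftBy _)).const_mul _).ennreal_ofReal
  exact integrable_toReal_of_lintegral_ne_top hm.aemeasurable
    (lintegral_discounted_ne_top hν hβ hβ1 hgm hgi _)

lemma past_shiftBy_one {x : ℤ → Vec p}
    (hx : Summable fun n : ℕ => β ^ n * g (shiftBy (-1 - (n : ℤ)) x)) :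
    past β g (shiftBy 1 x) = g x + β * past β g x := by
  have h0 : ∀ n : ℕ, β ^ (n + 1) * g (shiftBy (-1 - ((n + 1 : ℕ) : ℤ)) (shiftBy 1 x)) =
      β * (β ^ n * g (shiftBy (-1 - (n : ℤ)) x)) := by
    intro n
    rw [shiftBy_shiftBy, pow_succ', mul_assoc]
    congr 4
    push_cast
    ring
  have hs : Summable fun n : ℕ => β ^ n * g (shiftBy (-1 - (n : ℤ)) (shiftBy 1 x)) :=
    (summable_nat_add_iff 1).1 ((hx.mul_left β).congr fun n => (h0 n).symm)
  rw [past, hs.tsum_eq_zero_add, past, ← tsum_mul_left]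
  congr 1
  · simp [shiftBy_shiftBy, shiftBy_zero]
  · exact tsum_congr h0

lemma ae_past_shiftBy (hν : MeasurePreserving (shiftBy 1) ν ν) (hβ : 0 ≤ β) (hβ1 : β < 1)
    (hg : ∀ x, 0 ≤ g x) (hgm : Measurable g) (hgi : Integrable g ν) :
    ∀ᵐ x ∂ν, ∀ t : ℤ, past β g (shiftBy (t + 1) x) =
      g (shiftBy t x) + β * past β g (shiftBy t x) := by
  refine ae_all_iff.2 fun t => ?_
  filter_upwards [(measurePreserving_shiftBy hν t).quasiMeasurePreserving.ae
    (ae_summable_discounted hν hβ hβ1 hg hgm hgi _)] with x hx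
  rw [← past_shiftBy_one hx, shiftBy_shiftBy, add_comm]

/-- The ergodic theorem for the averages over `t = 1, …, n` of a function of the shifted path. -/
lemma ae_tendsto_average_shiftBy [IsProbabilityMeasure ν] (hν : Ergodic (shiftBy 1) ν)
    (hgm : Measurable g) (hgi : Integrable g ν) :
    ∀ᵐ x ∂ν, Tendsto (fun T : ℕ => (T : ℝ)⁻¹ * ∑ t ∈ Finset.Icc 1 T, g (shiftBy (t : ℤ) x)) atTop
      (𝓝 (∫ x, g x ∂ν)) := by
  -- Averages over `1, …, T` are Birkhoff averages started at the once-shifted path.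
  filter_upwards [hν.quasiMeasurePreserving.ae (ae_tendsto_birkhoffAverage hν hgm hgi)] with x hx
  refine hx.congr fun T => ?_
  congr 1
  rw [← Finset.Ico_add_one_right_eq_Icc, Finset.sum_Ico_eq_sum_range, birkhoffSum]
  refine Finset.sum_congr rfl fun k _ => ?_
  rw [iterate_shiftBy_one, shiftBy_shiftBy]
  congr 2
  push_cast
  ring

end Past

/-! ### Pathwise perturbation bounds for the recursion and the loss. -/

section Comparison

variable {p : ℕ}

/-- The squared `ℓ¹` norm. -/
def sqSize (x : Vec p) : ℝ := (∑ k, |x k|) ^ 2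

/-- The forcing term of the recursion of the `i`-th conditional eigenvalue. -/
def newsImpact (i : Fin p) (γ : Static p) (κ : Dynamic p) (x : Vec p) : ℝ :=
  intercept i γ.1 κ + ∑ j, κ.1 j * rotated γ.2 x j ^ 2

/-- Parameters that satisfy uniform bounds. -/
structure IsAdmissible (i : Fin p) (c A B β : ℝ) (γ : Static p) (κ : Dynamic p) : Prop where
  orthogonal : γ.2 ∈ Matrix.orthogonalGroup (Fin p) ℝ
  abs_eigenvalue_le : ∀ j, |γ.1 j| ≤ B
  a_nonneg : ∀ j, 0 ≤ κ.1 j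
  a_le : ∀ j, κ.1 j ≤ A
  b_nonneg : 0 ≤ κ.2
  b_le : κ.2 ≤ β
  le_intercept : c ≤ intercept i γ.1 κ

/-- Two parameters are entrywise within distance `δ`. -/
structure IsClose (δ : ℝ) (γ : Static p) (κ : Dynamic p) (γ' : Static p) (κ' : Dynamic p) :
    Prop where
  eigenvalue : ∀ j, |γ.1 j - γ'.1 j| ≤ δ
  eigenvector : ∀ j k, |γ.2 j k - γ'.2 j k| ≤ δ
  a : ∀ j, |κ.1 j - κ'.1 j| ≤ δ
  b : |κ.2 - κ'.2| ≤ δ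

lemma sqSize_nonneg (x : Vec p) : 0 ≤ sqSize x := sq_nonneg _

lemma abs_entry_le_one {V : Matrix (Fin p) (Fin p) ℝ}
    (hV : V ∈ Matrix.orthogonalGroup (Fin p) ℝ) (j k : Fin p) : |V j k| ≤ 1 := by
  simpa using entry_norm_bound_of_unitary hV j k

lemma abs_transpose_mulVec_le {M : Matrix (Fin p) (Fin p) ℝ} {δ : ℝ} (hM : ∀ j k, |M j k| ≤ δ)
    (x : Vec p) (j : Fin p) : |(Mᵀ *ᵥ x) j| ≤ δ * ∑ k, |x k| := by
  simp only [Matrix.mulVec, dotProduct, Matrix.transpose_apply]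
  refine (Finset.abs_sum_le_sum_abs _ _).trans ?_
  rw [Finset.mul_sum]
  refine Finset.sum_le_sum fun k _ => ?_
  rw [abs_mul]
  exact mul_le_mul_of_nonneg_right (hM k j) (abs_nonneg _)

lemma rotated_sq_le {V : Matrix (Fin p) (Fin p) ℝ} (hV : V ∈ Matrix.orthogonalGroup (Fin p) ℝ)
    (x : Vec p) (j : Fin p) : rotated V x j ^ 2 ≤ sqSize x := by
  have h := abs_transpose_mulVec_le (abs_entry_le_one hV) x j
  rw [one_mul] at h
  rw [sqSize, ← sq_abs (rotated V x j)]
  exact pow_le_pow_left₀ (abs_nonneg _) h 2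

lemma abs_rotated_sq_sub_le {V V' : Matrix (Fin p) (Fin p) ℝ}
    (hV : V ∈ Matrix.orthogonalGroup (Fin p) ℝ) (hV' : V' ∈ Matrix.orthogonalGroup (Fin p) ℝ)
    {δ : ℝ} (h : ∀ j k, |V j k - V' j k| ≤ δ) (x : Vec p) (j : Fin p) :
    |rotated V x j ^ 2 - rotated V' x j ^ 2| ≤ δ * (2 * sqSize x) := by
  have h1 := abs_transpose_mulVec_le (M := V - V') h x j
  have h2 : |rotated V x j + rotated V' x j| ≤ 2 * ∑ k, |x k| := by
    have h3 := abs_transpose_mulVec_le (abs_entry_le_one hV) x j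
    have h4 := abs_transpose_mulVec_le (abs_entry_le_one hV') x j
    refine (abs_add_le _ _).trans ?_
    simp only [rotated]
    linarith
  have h5 : (V - V')ᵀ *ᵥ x = rotated V x - rotated V' x := by
    simp [rotated, Matrix.transpose_sub, Matrix.sub_mulVec]
  rw [h5, Pi.sub_apply] at h1
  rw [sq_sub_sq, abs_mul, sqSize]
  calc _ ≤ (2 * ∑ k, |x k|) * (δ * ∑ k, |x k|) :=
        mul_le_mul h2 h1 (abs_nonneg _) (mul_nonneg zero_le_two
          (Finset.sum_nonneg fun _ _ => abs_nonneg _))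
    _ = _ := by ring

variable {i : Fin p} {c A B β δ : ℝ} {γ γ' : Static p} {κ κ' : Dynamic p}

lemma IsAdmissible.sum_nonneg (h : IsAdmissible i c A B β γ κ) (x : Vec p) :
    0 ≤ ∑ j, κ.1 j * rotated γ.2 x j ^ 2 :=
  Finset.sum_nonneg fun j _ => mul_nonneg (h.a_nonneg j) (sq_nonneg _)

lemma IsAdmissible.le_newsImpact (h : IsAdmissible i c A B β γ κ) (x : Vec p) :
    c ≤ newsImpact i γ κ x :=
  (le_add_of_nonneg_right (h.sum_nonneg x)).trans' h.le_intercept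

lemma sum_abs_le_card_mul {f : Fin p → ℝ} {M : ℝ} (hf : ∀ j, |f j| ≤ M) :
    |∑ j, f j| ≤ p * M := by
  refine (Finset.abs_sum_le_sum_abs _ _).trans
    ((Finset.sum_le_card_nsmul _ _ M fun j _ => hf j).trans ?_)
  simp

lemma IsAdmissible.newsImpact_le (h : IsAdmissible i c A B β γ κ) (hβ : β ≤ 1) (x : Vec p) :
    newsImpact i γ κ x ≤ (B + p * (A * B) + p * A) * (1 + sqSize x) := by
  have hA : 0 ≤ A := (h.a_nonneg i).trans (h.a_le i)
  have hB : 0 ≤ B := (abs_nonneg _).trans (h.abs_eigenvalue_le i)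
  have hN := sqSize_nonneg x
  have h1 : |∑ j, κ.1 j * γ.1 j| ≤ p * (A * B) := sum_abs_le_card_mul fun j => by
    rw [abs_mul, abs_of_nonneg (h.a_nonneg j)]
    exact mul_le_mul (h.a_le j) (h.abs_eigenvalue_le j) (abs_nonneg _) hA
  have h2 : |∑ j, κ.1 j * rotated γ.2 x j ^ 2| ≤ p * (A * sqSize x) :=
    sum_abs_le_card_mul fun j => by
      rw [abs_mul, abs_of_nonneg (h.a_nonneg j), abs_of_nonneg (sq_nonneg _)]
      exact mul_le_mul (h.a_le j) (rotated_sq_le h.orthogonal x j) (sq_nonneg _) hA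
  have h3 : (1 - κ.2) * γ.1 i ≤ 1 * B :=
    (mul_le_mul_of_nonneg_left ((le_abs_self _).trans (h.abs_eigenvalue_le i))
      (by linarith [h.b_le])).trans
      (mul_le_mul_of_nonneg_right (by linarith [h.b_nonneg]) hB)
  have h4 := (abs_le.1 h1).1
  have h5 := (abs_le.1 h2).2
  have hp : (0 : ℝ) ≤ p := p.cast_nonneg
  have h6 : 0 ≤ (B + p * (A * B)) * sqSize x := by positivity
  have h7 : 0 ≤ p * A := by positivity
  rw [newsImpact, intercept]
  nlinarith

/-- Each product of parameters is split by adding and subtracting a mixed term, so the error is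
linear in `δ` and grows in `x` no faster than `sqSize`. -/
lemma abs_newsImpact_sub_le (h : IsAdmissible i c A B β γ κ) (h' : IsAdmissible i c A B β γ' κ')
    (hβ : β ≤ 1) (hδ : IsClose δ γ κ γ' κ') (x : Vec p) :
    |newsImpact i γ κ x - newsImpact i γ' κ' x| ≤
      δ * ((1 + B + p * (A + B) + p * (2 * A + 1)) * (1 + sqSize x)) := by
  have hA : 0 ≤ A := (h.a_nonneg i).trans (h.a_le i)
  have hB : 0 ≤ B := (abs_nonneg _).trans (h.abs_eigenvalue_le i)
  have hδ0 : 0 ≤ δ := (abs_nonneg _).trans hδ.b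
  have hN := sqSize_nonneg x
  have hp : (0 : ℝ) ≤ p := p.cast_nonneg
  have h1 : |(1 - κ.2) * (γ.1 i - γ'.1 i)| ≤ 1 * δ := by
    rw [abs_mul]
    refine mul_le_mul ?_ (hδ.eigenvalue i) (abs_nonneg _) zero_le_one
    rw [abs_le]
    constructor <;> linarith [h.b_nonneg, h.b_le]
  have h2 : |(κ.2 - κ'.2) * γ'.1 i| ≤ δ * B := by
    rw [abs_mul]
    exact mul_le_mul hδ.b (h'.abs_eigenvalue_le i) (abs_nonneg _) hδ0
  have h3 : |∑ j, (κ.1 j * (γ.1 j - γ'.1 j) + (κ.1 j - κ'.1 j) * γ'.1 j)| ≤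
      p * (A * δ + δ * B) := sum_abs_le_card_mul fun j => by
    refine (abs_add_le _ _).trans (add_le_add ?_ ?_)
    · rw [abs_mul, abs_of_nonneg (h.a_nonneg j)]
      exact mul_le_mul (h.a_le j) (hδ.eigenvalue j) (abs_nonneg _) hA
    · rw [abs_mul]
      exact mul_le_mul (hδ.a j) (h'.abs_eigenvalue_le j) (abs_nonneg _) hδ0
  have h4 : |∑ j, (κ.1 j * (rotated γ.2 x j ^ 2 - rotated γ'.2 x j ^ 2) +
      (κ.1 j - κ'.1 j) * rotated γ'.2 x j ^ 2)| ≤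
      p * (A * (δ * (2 * sqSize x)) + δ * sqSize x) := sum_abs_le_card_mul fun j => by
    refine (abs_add_le _ _).trans (add_le_add ?_ ?_)
    · rw [abs_mul, abs_of_nonneg (h.a_nonneg j)]
      exact mul_le_mul (h.a_le j) (abs_rotated_sq_sub_le h.orthogonal h'.orthogonal
        hδ.eigenvector x j) (abs_nonneg _) hA
    · rw [abs_mul, abs_of_nonneg (sq_nonneg (rotated γ'.2 x j))]
      exact mul_le_mul (hδ.a j) (rotated_sq_le h'.orthogonal x j) (sq_nonneg _) hδ0
  have h5 : newsImpact i γ κ x - newsImpact i γ' κ' x =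
      (1 - κ.2) * (γ.1 i - γ'.1 i) - (κ.2 - κ'.2) * γ'.1 i -
      ∑ j, (κ.1 j * (γ.1 j - γ'.1 j) + (κ.1 j - κ'.1 j) * γ'.1 j) +
      ∑ j, (κ.1 j * (rotated γ.2 x j ^ 2 - rotated γ'.2 x j ^ 2) +
      (κ.1 j - κ'.1 j) * rotated γ'.2 x j ^ 2) := by
    simp only [newsImpact, intercept, mul_sub, sub_mul, Finset.sum_add_distrib,
      Finset.sum_sub_distrib]
    ring
  have h6 : 0 ≤ δ * ((1 + B + p * (A + B)) * sqSize x) := by positivity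
  have h7 : 0 ≤ δ * (p * (2 * A + 1)) := by positivity
  rw [h5]
  rw [abs_le] at h1 h2 h3 h4 ⊢
  constructor <;> nlinarith

/-- The news impact is bounded, and Lipschitz in the parameters, with constants that are uniform
over admissible parameters and affine in `sqSize`. -/
lemma exists_newsImpact_bounds (i : Fin p) (c : ℝ) {A B β : ℝ} (hA : 0 ≤ A) (hB : 0 ≤ B)
    (hβ : β ≤ 1) : ∃ C, 0 ≤ C ∧
      (∀ γ κ, IsAdmissible i c A B β γ κ → ∀ x, newsImpact i γ κ x ≤ C * (1 + sqSize x)) ∧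
      ∀ γ κ γ' κ' δ, IsAdmissible i c A B β γ κ → IsAdmissible i c A B β γ' κ' →
        IsClose δ γ κ γ' κ' → ∀ x,
        |newsImpact i γ κ x - newsImpact i γ' κ' x| ≤ δ * (C * (1 + sqSize x)) := by
  refine ⟨(B + p * (A * B) + p * A) + (1 + B + p * (A + B) + p * (2 * A + 1)), by positivity,
    fun γ κ h x => ?_, fun γ κ γ' κ' δ h h' hδ x => ?_⟩
  · refine (h.newsImpact_le hβ x).trans (mul_le_mul_of_nonneg_right ?_ ?_)
    · exact le_add_of_nonneg_right (by positivity)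
    · exact add_nonneg zero_le_one (sqSize_nonneg x)
  · refine (abs_newsImpact_sub_le h h' hβ hδ x).trans (mul_le_mul_of_nonneg_left
      (mul_le_mul_of_nonneg_right ?_ ?_) ((abs_nonneg _).trans hδ.b))
    · exact le_add_of_nonneg_left (by positivity)
    · exact add_nonneg zero_le_one (sqSize_nonneg x)

/-- The starting value is only known to be nonnegative; the bound `c` comes from the forcing term,
hence holds from time `1` on, where the likelihood starts. -/
lemma IsAdmissible.le_eigFilter (h : IsAdmissible i c A B β γ κ) (hc : 0 ≤ c)
    {H : Matrix (Fin p) (Fin p) ℝ} (hH : H.PosDef) (x : ℕ → Vec p) (t : ℕ) :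
    0 ≤ eigFilter i H x γ κ t ∧ c ≤ eigFilter i H x γ κ (t + 1) := by
  have hstep : ∀ t, 0 ≤ eigFilter i H x γ κ t → c ≤ eigFilter i H x γ κ (t + 1) := fun t ht => by
    have := h.le_newsImpact (x t)
    have := mul_nonneg h.b_nonneg ht
    simp only [eigFilter, newsImpact] at *
    linarith
  have hpos : ∀ t, 0 ≤ eigFilter i H x γ κ t := fun t => by
    induction t with
    | zero => simpa [eigFilter] using hH.posSemidef.dotProduct_mulVec_nonneg (γ.2ᵀ i)
    | succ t ih => exact hc.trans (hstep t ih)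
  exact ⟨hpos t, hstep t (hpos t)⟩

lemma IsAdmissible.eigFilter_zero_le (h : IsAdmissible i c A B β γ κ)
    (H : Matrix (Fin p) (Fin p) ℝ) (x : ℕ → Vec p) :
    eigFilter i H x γ κ 0 ≤ ∑ j, ∑ k, |H j k| := by
  simp only [eigFilter, dotProduct, Matrix.mulVec, Matrix.transpose_apply]
  refine Finset.sum_le_sum fun j _ => ?_
  rw [Finset.mul_sum]
  refine Finset.sum_le_sum fun k _ => ?_
  refine (le_abs_self _).trans ?_
  rw [abs_mul, abs_mul]
  have h1 := abs_entry_le_one h.orthogonal j i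
  have h2 := abs_entry_le_one h.orthogonal k i
  calc |γ.2 j i| * (|H j k| * |γ.2 k i|) ≤ 1 * (|H j k| * 1) := by gcongr
    _ = |H j k| := by ring

/-- Perturbation of a linear recursion. -/
lemma abs_recursion_sub_le {s s' u u' q Q : ℕ → ℝ} {b b' β δ R : ℝ} (hb : 0 ≤ b) (hbβ : b ≤ β)
    (hs : ∀ t, s (t + 1) = u t + b * s t) (hs' : ∀ t, s' (t + 1) = u' t + b' * s' t)
    (hs0 : ∀ t, 0 ≤ s' t) (hQ : ∀ t, Q (t + 1) = q t + s' t + β * Q t) (hQ0 : ∀ t, 0 ≤ Q t)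
    (hu : ∀ t, |u t - u' t| ≤ δ * q t) (hbb : |b - b'| ≤ δ) (hR : |s 0 - s' 0| ≤ R) (t : ℕ) :
    |s t - s' t| ≤ δ * Q t + β ^ t * R := by
  induction t with
  | zero =>
    have := mul_nonneg ((abs_nonneg _).trans hbb) (hQ0 0)
    simp only [pow_zero, one_mul]
    linarith
  | succ t ih =>
    -- The last term is the reason why `Q` accumulates `s'` in addition to `q`.
    have h1 : s (t + 1) - s' (t + 1) = (u t - u' t) + b * (s t - s' t) + (b - b') * s' t := by
      rw [hs, hs']; ring
    have h2 : |b * (s t - s' t)| ≤ β * (δ * Q t + β ^ t * R) := by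
      rw [abs_mul, abs_of_nonneg hb]
      exact mul_le_mul hbβ ih (abs_nonneg _) (hb.trans hbβ)
    have h3 : |(b - b') * s' t| ≤ δ * s' t := by
      rw [abs_mul, abs_of_nonneg (hs0 t)]
      exact mul_le_mul_of_nonneg_right hbb (hs0 t)
    rw [h1, hQ, pow_succ']
    calc _ ≤ |u t - u' t| + |b * (s t - s' t)| + |(b - b') * s' t| := abs_add_three _ _ _
      _ ≤ δ * q t + β * (δ * Q t + β ^ t * R) + δ * s' t := by linarith [hu t]
      _ = _ := by ring

/-- Perturbation of one term of the quasi-likelihood. -/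
lemma abs_loss_sub_le {c s s' y y' Q N e δ : ℝ} (hc : 0 < c) (hs : c ≤ s) (hs' : c ≤ s')
    (h : |s - s'| ≤ δ * Q + e) (he : 0 ≤ e) (hδQ : 0 ≤ δ * Q) (hy' : 0 ≤ y') (hyN : y' ≤ N)
    (hyy : |y - y'| ≤ δ * (2 * N)) :
    |(Real.log s + y / s) - (Real.log s' + y' / s')| ≤
      δ * (Q / c + 2 * N / c) + N * min (1 / c) (δ * Q / c ^ 2) + e * (1 / c + N / c ^ 2) := by
  have hs0 : 0 < s := hc.trans_le hs
  have hs0' : 0 < s' := hc.trans_le hs'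
  have hN : 0 ≤ N := hy'.trans hyN
  have hlog : |Real.log s - Real.log s'| ≤ (δ * Q + e) / c := by
    have key : ∀ a b : ℝ, c ≤ a → c ≤ b → |a - b| ≤ δ * Q + e →
        Real.log a - Real.log b ≤ (δ * Q + e) / c := by
      intro a b ha hb hab
      have ha0 : 0 < a := hc.trans_le ha
      have hb0 : 0 < b := hc.trans_le hb
      rw [← Real.log_div ha0.ne' hb0.ne']
      have h1 := Real.log_le_sub_one_of_pos (div_pos ha0 hb0)
      have h2 : a / b - 1 = (a - b) / b := by field_simp
      calc _ ≤ (a - b) / b := by rw [← h2]; exact h1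
        _ ≤ (δ * Q + e) / b := by gcongr; exact (le_abs_self _).trans hab
        _ ≤ (δ * Q + e) / c := by gcongr
    rw [abs_le]
    constructor
    · linarith [key s' s hs' hs (by rwa [abs_sub_comm])]
    · exact key s s' hs hs' h
  -- The crude bound `1 / c` keeps the product with `N` integrable, the Lipschitz bound makes it
  -- small with `δ`. The transient error `e` stays outside the minimum, so that it can be summed
  -- separately.
  have hinv : |1 / s - 1 / s'| ≤ min (1 / c) (δ * Q / c ^ 2) + e / c ^ 2 := by
    have h1 : |1 / s - 1 / s'| ≤ 1 / c := by
      have h2 : 1 / s ≤ 1 / c := by gcongr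
      have h3 : 1 / s' ≤ 1 / c := by gcongr
      have h4 : 0 < 1 / s := by positivity
      have h5 : 0 < 1 / s' := by positivity
      rw [abs_le]
      constructor <;> linarith
    have h2 : |1 / s - 1 / s'| ≤ δ * Q / c ^ 2 + e / c ^ 2 := by
      have h3 : 1 / s - 1 / s' = (s' - s) / (s * s') := by field_simp
      rw [h3, abs_div, abs_sub_comm, abs_of_pos (mul_pos hs0 hs0'), ← add_div]
      have h4 : c ^ 2 ≤ s * s' := by rw [sq]; exact mul_le_mul hs hs' hc.le hs0.le
      gcongr
    rw [← min_add_add_right]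
    exact le_min (h1.trans (le_add_of_nonneg_right (by positivity))) h2
  have hsplit : (Real.log s + y / s) - (Real.log s' + y' / s') =
      (Real.log s - Real.log s') + (y - y') / s + y' * (1 / s - 1 / s') := by ring
  have h1 : |(y - y') / s| ≤ δ * (2 * N) / c := by
    rw [abs_div, abs_of_pos hs0]
    have : 0 ≤ δ * (2 * N) := (abs_nonneg _).trans hyy
    gcongr
  have h2 : |y' * (1 / s - 1 / s')| ≤ N * (min (1 / c) (δ * Q / c ^ 2) + e / c ^ 2) := by
    rw [abs_mul, abs_of_nonneg hy']
    exact mul_le_mul hyN hinv (abs_nonneg _) hN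
  rw [hsplit]
  calc _ ≤ |Real.log s - Real.log s'| + |(y - y') / s| + |y' * (1 / s - 1 / s')| :=
        abs_add_three _ _ _
    _ ≤ (δ * Q + e) / c + δ * (2 * N) / c + N * (min (1 / c) (δ * Q / c ^ 2) + e / c ^ 2) := by
        linarith
    _ = _ := by ring

end Comparison

/-! ### Locally uniform law of large numbers for the quasi-likelihood. -/

section Likelihood

variable {p : ℕ}

/-- The stationary conditional eigenvalue as a function of the path of returns. -/
noncomputable def eigPath (i : Fin p) (γ : Static p) (κ : Dynamic p) (x : ℤ → Vec p) : ℝ :=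
  past κ.2 (fun x => newsImpact i γ κ (x 0)) x

/-- The stationary term of the quasi-likelihood as a function of the path of returns. -/
noncomputable def lossPath (i : Fin p) (γ : Static p) (κ : Dynamic p) (x : ℤ → Vec p) : ℝ :=
  Real.log (eigPath i γ κ x) + rotated γ.2 (x 0) i ^ 2 / eigPath i γ κ x

lemma measurable_rotated (V : Matrix (Fin p) (Fin p) ℝ) (j : Fin p) :
    Measurable fun x : Vec p => rotated V x j := by
  simp only [rotated, Matrix.mulVec, dotProduct]
  fun_prop

lemma measurable_newsImpact (i : Fin p) (γ : Static p) (κ : Dynamic p) :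
    Measurable (newsImpact i γ κ) := by
  have := measurable_rotated γ.2
  unfold newsImpact
  fun_prop

lemma measurable_sqSize : Measurable (sqSize : Vec p → ℝ) := by
  unfold sqSize
  fun_prop

lemma measurable_eigPath (i : Fin p) (γ : Static p) (κ : Dynamic p) :
    Measurable (eigPath i γ κ) :=
  measurable_past ((measurable_newsImpact i γ κ).comp (measurable_pi_apply 0))

lemma measurable_lossPath (i : Fin p) (γ : Static p) (κ : Dynamic p) :
    Measurable (lossPath i γ κ) :=
  (measurable_eigPath i γ κ).log.add
    ((((measurable_rotated γ.2 i).comp (measurable_pi_apply 0)).pow_const 2).div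
      (measurable_eigPath i γ κ))

variable {i : Fin p} {c A B β : ℝ} {γ γ' : Static p} {κ κ' : Dynamic p}
  {ν : Measure (ℤ → Vec p)}

/-- The modulus of continuity of the quasi-likelihood terms at distance `δ`. -/
noncomputable def lossModulus (c : ℝ) (Q : (ℤ → Vec p) → ℝ) (δ : ℝ) (x : ℤ → Vec p) : ℝ :=
  δ * (Q x / c + 2 * sqSize (x 0) / c) + sqSize (x 0) * min (1 / c) (δ * Q x / c ^ 2)

lemma measurable_lossModulus {Q : (ℤ → Vec p) → ℝ} (hQ : Measurable Q) (δ : ℝ) :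
    Measurable (lossModulus c Q δ) := by
  have h := measurable_sqSize.comp (measurable_pi_apply (X := fun _ : ℤ => Vec p) 0)
  have h' : Measurable fun x : ℤ → Vec p => sqSize (x 0) := h
  unfold lossModulus
  fun_prop

lemma norm_lossModulus_le {Q : (ℤ → Vec p) → ℝ} (hc : 0 < c) (hQ : ∀ x, 0 ≤ Q x) {δ : ℝ}
    (hδ : 0 ≤ δ) (hδ1 : δ ≤ 1) (x : ℤ → Vec p) :
    ‖lossModulus c Q δ x‖ ≤ (Q x / c + 2 * sqSize (x 0) / c) + sqSize (x 0) * (1 / c) := by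
  have h1 := hQ x
  have h2 := sqSize_nonneg (x 0)
  have h3 : 0 ≤ min (1 / c) (δ * Q x / c ^ 2) := le_min (by positivity) (by positivity)
  rw [lossModulus, Real.norm_of_nonneg (by positivity)]
  refine add_le_add (mul_le_of_le_one_left (by positivity) hδ1)
    (mul_le_mul_of_nonneg_left (min_le_left _ _) h2)

lemma integrable_lossModulus_bound {Q : (ℤ → Vec p) → ℝ} (hQi : Integrable Q ν)
    (hN : Integrable (fun x => sqSize (x 0)) ν) :
    Integrable (fun x : ℤ → Vec p => (Q x / c + 2 * sqSize (x 0) / c) + sqSize (x 0) * (1 / c)) ν :=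
  ((hQi.div_const c).add ((hN.const_mul 2).div_const c)).add (hN.mul_const _)

/-- The modulus vanishes pointwise as `δ` does. The minimum provides a dominating function that
involves `sqSize` and `Q` separately, never their product. -/
lemma tendsto_integral_lossModulus {Q : (ℤ → Vec p) → ℝ} (hc : 0 < c) (hQm : Measurable Q)
    (hQ : ∀ x, 0 ≤ Q x) (hQi : Integrable Q ν) (hN : Integrable (fun x => sqSize (x 0)) ν) :
    Tendsto (fun n : ℕ => ∫ x, lossModulus c Q (1 / ((n : ℝ) + 1)) x ∂ν) atTop (𝓝 0) := by
  have h0 : Tendsto (fun n : ℕ => 1 / ((n : ℝ) + 1)) atTop (𝓝 0) :=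
    tendsto_one_div_add_atTop_nhds_zero_nat
  have h := tendsto_integral_of_dominated_convergence (μ := ν) (f := fun _ => (0 : ℝ)) _
    (fun n : ℕ => (measurable_lossModulus (c := c) hQm (1 / ((n : ℝ) + 1))).aestronglyMeasurable)
    (integrable_lossModulus_bound (c := c) hQi hN)
    (fun n => Eventually.of_forall fun x => norm_lossModulus_le hc hQ
      Nat.one_div_pos_of_nat.le
      (by rw [div_le_one (by positivity)]; linarith [n.cast_nonneg (α := ℝ)]) x)
    (Eventually.of_forall fun x => ?_)
  · simpa using h
  · have h1 : Continuous fun δ : ℝ => lossModulus c Q δ x := by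
      unfold lossModulus
      fun_prop
    have h2 := (h1.tendsto 0).comp h0
    have h3 : lossModulus c Q 0 x = 0 := by
      have : (0 : ℝ) ≤ c⁻¹ := by positivity
      simp [lossModulus, this]
    rwa [h3] at h2

variable [IsProbabilityMeasure ν]

lemma integrable_newsImpact (i : Fin p) (γ : Static p) (κ : Dynamic p)
    (hV : γ.2 ∈ Matrix.orthogonalGroup (Fin p) ℝ)
    (hN : Integrable (fun x => sqSize (x 0)) ν) :
    Integrable (fun x => newsImpact i γ κ (x 0)) ν := by
  refine (integrable_const _).add (integrable_finsetSum _ fun j _ => Integrable.const_mul ?_ _)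
  refine hN.mono' (((measurable_rotated γ.2 j).comp
    (measurable_pi_apply 0)).pow_const 2).aestronglyMeasurable (Eventually.of_forall fun x => ?_)
  rw [Real.norm_of_nonneg (sq_nonneg _)]
  exact rotated_sq_le hV _ _

lemma IsAdmissible.integrable_eigPath (h : IsAdmissible i c A B β γ κ) (hc : 0 ≤ c) (hβ : β < 1)
    (hν : MeasurePreserving (shiftBy 1) ν ν) (hN : Integrable (fun x => sqSize (x 0)) ν) :
    Integrable (eigPath i γ κ) ν :=
  integrable_past hν h.b_nonneg (h.b_le.trans_lt hβ) (fun x => hc.trans (h.le_newsImpact (x 0)))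
    ((measurable_newsImpact i γ κ).comp (measurable_pi_apply 0))
    (integrable_newsImpact i γ κ h.orthogonal hN)

lemma IsAdmissible.ae_eigPath_shiftBy (h : IsAdmissible i c A B β γ κ) (hc : 0 ≤ c) (hβ : β < 1)
    (hν : MeasurePreserving (shiftBy 1) ν ν) (hN : Integrable (fun x => sqSize (x 0)) ν) :
    ∀ᵐ x ∂ν, ∀ t : ℤ, eigPath i γ κ (shiftBy (t + 1) x) =
      newsImpact i γ κ (x t) + κ.2 * eigPath i γ κ (shiftBy t x) := by
  simpa only [eigPath, shiftBy, zero_add] using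
    ae_past_shiftBy hν h.b_nonneg (h.b_le.trans_lt hβ)
      (fun x => hc.trans (h.le_newsImpact (x 0)))
      ((measurable_newsImpact i γ κ).comp (measurable_pi_apply 0))
      (integrable_newsImpact i γ κ h.orthogonal hN)

lemma IsAdmissible.eigPath_nonneg (h : IsAdmissible i c A B β γ κ) (hc : 0 ≤ c)
    (x : ℤ → Vec p) : 0 ≤ eigPath i γ κ x :=
  past_nonneg h.b_nonneg (fun x => hc.trans (h.le_newsImpact (x 0))) x

/-- This is only almost sure: on paths with a divergent series `eigPath` takes the default value
`0`. The recursion, available almost surely, gives the bound. -/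
lemma IsAdmissible.ae_le_eigPath (h : IsAdmissible i c A B β γ κ) (hc : 0 ≤ c) (hβ : β < 1)
    (hν : MeasurePreserving (shiftBy 1) ν ν) (hN : Integrable (fun x => sqSize (x 0)) ν) :
    ∀ᵐ x ∂ν, ∀ t : ℤ, c ≤ eigPath i γ κ (shiftBy t x) := by
  filter_upwards [h.ae_eigPath_shiftBy hc hβ hν hN] with x hx t
  have h1 := hx (t - 1)
  rw [sub_add_cancel] at h1
  rw [h1]
  exact (h.le_newsImpact _).trans
    (le_add_of_nonneg_right (mul_nonneg h.b_nonneg (h.eigPath_nonneg hc _)))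

lemma abs_log_le_of_le {c s : ℝ} (hc : 0 < c) (hs : c ≤ s) :
    |Real.log s| ≤ |Real.log c| + s := by
  have h1 := Real.log_le_log hc hs
  have h2 := Real.log_le_self (hc.le.trans hs)
  have h3 := neg_abs_le (Real.log c)
  have h4 := abs_nonneg (Real.log c)
  rw [abs_le]
  constructor <;> linarith

lemma IsAdmissible.integrable_rotated_sq_div (h : IsAdmissible i c A B β γ κ) (hc : 0 < c)
    (hβ : β < 1) (hν : MeasurePreserving (shiftBy 1) ν ν)
    (hN : Integrable (fun x => sqSize (x 0)) ν) :
    Integrable (fun x => rotated γ.2 (x 0) i ^ 2 / eigPath i γ κ x) ν := by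
  refine (hN.div_const c).mono' ((((measurable_rotated γ.2 i).comp
    (measurable_pi_apply 0)).pow_const 2).div
      (measurable_eigPath i γ κ)).aestronglyMeasurable ?_
  filter_upwards [h.ae_le_eigPath hc.le hβ hν hN] with x hx
  have h1 := hx 0
  rw [shiftBy_zero] at h1
  have h2 := hc.trans_le h1
  rw [Real.norm_of_nonneg (by positivity)]
  have := rotated_sq_le h.orthogonal (x 0) i
  have := sqSize_nonneg (x 0)
  gcongr

lemma IsAdmissible.integrable_log_eigPath (h : IsAdmissible i c A B β γ κ) (hc : 0 < c)
    (hβ : β < 1) (hν : MeasurePreserving (shiftBy 1) ν ν)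
    (hN : Integrable (fun x => sqSize (x 0)) ν) :
    Integrable (fun x => Real.log (eigPath i γ κ x)) ν := by
  refine ((integrable_const |Real.log c|).add (h.integrable_eigPath hc.le hβ hν hN)).mono'
    (measurable_eigPath i γ κ).log.aestronglyMeasurable ?_
  filter_upwards [h.ae_le_eigPath hc.le hβ hν hN] with x hx
  have h1 := hx 0
  rw [shiftBy_zero] at h1
  exact abs_log_le_of_le hc h1

lemma IsAdmissible.integrable_lossPath (h : IsAdmissible i c A B β γ κ) (hc : 0 < c)
    (hβ : β < 1) (hν : MeasurePreserving (shiftBy 1) ν ν)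
    (hN : Integrable (fun x => sqSize (x 0)) ν) :
    Integrable (lossPath i γ κ) ν :=
  (h.integrable_log_eigPath hc hβ hν hN).add (h.integrable_rotated_sq_div hc hβ hν hN)

lemma sum_Icc_one_eq_sum_range (f : ℕ → ℝ) (T : ℕ) :
    ∑ t ∈ Finset.Icc 1 T, f t = ∑ k ∈ Finset.range T, f (k + 1) := by
  rw [← Finset.Ico_add_one_right_eq_Icc, Finset.sum_Ico_eq_sum_range]
  exact Finset.sum_congr rfl fun k _ => by rw [add_comm]

/-- Locally uniform law of large numbers for the quasi-likelihood with arbitrary initial values. -/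
theorem exists_ae_eventually_abs_quasiLik_sub_lt (hν : Ergodic (shiftBy 1) ν)
    (hN : Integrable (fun x => sqSize (x 0)) ν) (hc : 0 < c) (hβ : β < 1)
    (h' : IsAdmissible i c A B β γ' κ') {H : Matrix (Fin p) (Fin p) ℝ} (hH : H.PosDef)
    {ε : ℝ} (hε : 0 < ε) :
    ∃ δ > 0, ∀ᵐ x ∂ν, ∀ d : ℕ → Vec p, (∀ t : ℕ, d (t + 1) = x ((t : ℤ) + 1)) →
      ∀ᶠ T : ℕ in atTop, ∀ γ κ, IsAdmissible i c A B β γ κ → IsClose δ γ κ γ' κ' →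
        |quasiLik i H d T γ κ - ∫ x, lossPath i γ' κ' x ∂ν| < ε := by
  have hA : 0 ≤ A := (h'.a_nonneg i).trans (h'.a_le i)
  have hB : 0 ≤ B := (abs_nonneg _).trans (h'.abs_eigenvalue_le i)
  have hβ0 : 0 ≤ β := h'.b_nonneg.trans h'.b_le
  have hmp := hν.toMeasurePreserving
  obtain ⟨C, hC, hnews, hlip⟩ := exists_newsImpact_bounds i c hA hB hβ.le
  have hmN : Measurable fun x : ℤ → Vec p => sqSize (x 0) :=
    measurable_sqSize.comp (measurable_pi_apply 0)
  have hq0 : ∀ x : ℤ → Vec p, 0 ≤ C * (1 + sqSize (x 0)) + eigPath i γ' κ' x := fun x =>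
    add_nonneg (mul_nonneg hC (add_nonneg zero_le_one (sqSize_nonneg _)))
      (h'.eigPath_nonneg hc.le x)
  have hqm : Measurable fun x : ℤ → Vec p => C * (1 + sqSize (x 0)) + eigPath i γ' κ' x :=
    ((hmN.const_add 1).const_mul C).add (measurable_eigPath i γ' κ')
  have hqi : Integrable (fun x : ℤ → Vec p => C * (1 + sqSize (x 0)) + eigPath i γ' κ' x) ν :=
    (((integrable_const 1).add hN).const_mul C).add (h'.integrable_eigPath hc.le hβ hmp hN)
  -- `Q` is the stationary solution of the error recursion at the uniform discount rate `β`; its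
  -- second summand pays for the error in `b`.
  set Q := past β fun x : ℤ → Vec p => C * (1 + sqSize (x 0)) + eigPath i γ' κ' x with hQdef
  have hQm : Measurable Q := measurable_past hqm
  have hQ0 : ∀ x, 0 ≤ Q x := past_nonneg hβ0 hq0
  have hQi : Integrable Q ν := integrable_past hmp hβ0 hβ hq0 hqm hqi
  -- The radius depends only on the law, not on the path. Three errors below `ε / 4` will be added:
  -- modulus, ergodic average and initial values.
  obtain ⟨m, hm⟩ := ((tendsto_integral_lossModulus hc hQm hQ0 hQi hN).eventually_lt_const
    (show (0 : ℝ) < ε / 4 by positivity)).exists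
  set δ : ℝ := 1 / ((m : ℝ) + 1) with hδdef
  have hδ : 0 < δ := Nat.one_div_pos_of_nat
  have hδ1 : δ ≤ 1 := by
    rw [hδdef, div_le_one (by positivity)]
    linarith [m.cast_nonneg (α := ℝ)]
  have hMm : Measurable (lossModulus (p := p) c Q δ) := measurable_lossModulus hQm δ
  have hMi : Integrable (lossModulus c Q δ) ν :=
    (integrable_lossModulus_bound (c := c) hQi hN).mono' hMm.aestronglyMeasurable
      (Eventually.of_forall (norm_lossModulus_le hc hQ0 hδ.le hδ1))
  have hwm : Measurable fun x : ℤ → Vec p => 1 / c + sqSize (x 0) / c ^ 2 :=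
    (hmN.div_const _).const_add _
  have hw0 : ∀ x : ℤ → Vec p, 0 ≤ 1 / c + sqSize (x 0) / c ^ 2 := fun x => by
    have := sqSize_nonneg (x 0)
    positivity
  have hwi : Integrable (fun x : ℤ → Vec p => 1 / c + sqSize (x 0) / c ^ 2) ν :=
    (integrable_const _).add (hN.div_const _)
  refine ⟨δ, hδ, ?_⟩
  filter_upwards [ae_tendsto_average_shiftBy hν hMm hMi,
    ae_tendsto_average_shiftBy hν (measurable_lossPath i γ' κ')
      (h'.integrable_lossPath hc hβ hmp hN),
    ae_summable_discounted hmp hβ0 hβ hw0 hwm hwi fun n => (n : ℤ) + 1,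
    h'.ae_eigPath_shiftBy hc.le hβ hmp hN, h'.ae_le_eigPath hc.le hβ hmp hN,
    ae_past_shiftBy hmp hβ0 hβ hq0 hqm hqi] with x hx1 hx2 hx3 hx4 hx5 hx6 d hd
  -- Since `d 0` is unrelated to `x 0`, the two recursions are compared from time `1`, where both
  -- eigenvalues lie between `0` and `R`.
  set R := C * (1 + sqSize (d 0)) + ∑ j, ∑ k, |H j k| + eigPath i γ' κ' (shiftBy 1 x) with hR
  have hHs : 0 ≤ ∑ j, ∑ k, |H j k| :=
    Finset.sum_nonneg fun _ _ => Finset.sum_nonneg fun _ _ => abs_nonneg _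
  have hR0 : 0 ≤ R := by
    have := sqSize_nonneg (d 0)
    have := h'.eigPath_nonneg hc.le (shiftBy 1 x)
    positivity
  have hterm : ∀ γ κ, IsAdmissible i c A B β γ κ → IsClose δ γ κ γ' κ' → ∀ t : ℕ,
      |(Real.log (eigFilter i H d γ κ (t + 1)) +
        rotated γ.2 (d (t + 1)) i ^ 2 / eigFilter i H d γ κ (t + 1)) -
        lossPath i γ' κ' (shiftBy ((t + 1 : ℕ) : ℤ) x)| ≤
      lossModulus c Q δ (shiftBy ((t + 1 : ℕ) : ℤ) x) +
        R * (β ^ t * (1 / c + sqSize (shiftBy ((t : ℤ) + 1) x 0) / c ^ 2)) := by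
    intro γ κ h hcl t
    have hrec := abs_recursion_sub_le (s := fun t => eigFilter i H d γ κ (t + 1))
      (s' := fun t : ℕ => eigPath i γ' κ' (shiftBy ((t : ℤ) + 1) x))
      (u := fun t => newsImpact i γ κ (d (t + 1)))
      (u' := fun t : ℕ => newsImpact i γ' κ' (x ((t : ℤ) + 1)))
      (q := fun t : ℕ => C * (1 + sqSize (x ((t : ℤ) + 1))))
      (Q := fun t : ℕ => Q (shiftBy ((t : ℤ) + 1) x)) (b := κ.2) (b' := κ'.2) (β := β)
      (δ := δ) (R := R) h.b_nonneg h.b_le (fun t => rfl)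
      (fun t => by
        have := hx4 ((t : ℤ) + 1)
        push_cast
        exact this)
      (fun t => h'.eigPath_nonneg hc.le _)
      (fun t => by
        have := hx6 ((t : ℤ) + 1)
        simp only [shiftBy, zero_add] at this
        push_cast
        simpa only [shiftBy] using this)
      (fun t => hQ0 _)
      (fun t => by
        rw [hd t]
        exact hlip γ κ γ' κ' δ h h' hcl _)
      hcl.b
      (by
        have h1 := (h.le_eigFilter hc.le hH d 0).2
        have h2 := h'.eigPath_nonneg hc.le (shiftBy 1 x)
        have h3 := hnews γ κ h (d 0)
        have h4 := h.eigFilter_zero_le H d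
        have h5 : κ.2 * eigFilter i H d γ κ 0 ≤ 1 * ∑ j, ∑ k, |H j k| :=
          mul_le_mul (h.b_le.trans hβ.le) h4 (h.le_eigFilter hc.le hH d 0).1 zero_le_one
        have h6 : eigFilter i H d γ κ (0 + 1) =
            newsImpact i γ κ (d 0) + κ.2 * eigFilter i H d γ κ 0 := rfl
        have h7 : 0 ≤ C * (1 + sqSize (d 0)) :=
          mul_nonneg hC (add_nonneg zero_le_one (sqSize_nonneg _))
        simp only [Nat.cast_zero, zero_add] at *
        rw [abs_le]
        constructor <;> linarith)
      t
    have hx0 : shiftBy ((t : ℤ) + 1) x 0 = x ((t : ℤ) + 1) := by simp [shiftBy]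
    have := abs_loss_sub_le (y := rotated γ.2 (d (t + 1)) i ^ 2) hc
      (h.le_eigFilter hc.le hH d t).2 (hx5 ((t : ℤ) + 1)) hrec
      (mul_nonneg (pow_nonneg hβ0 t) hR0) (mul_nonneg hδ.le (hQ0 _)) (sq_nonneg _)
      (rotated_sq_le h'.orthogonal (x ((t : ℤ) + 1)) i)
      (by
        rw [hd t]
        exact abs_rotated_sq_sub_le h.orthogonal h'.orthogonal hcl.eigenvector _ _)
    rw [lossPath, lossModulus]
    push_cast
    rw [hx0]
    refine this.trans (le_of_eq ?_)
    ring
  -- The initial values contribute at most a convergent series in total, which disappears after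
  -- division by `T`.
  have hlim : Tendsto (fun T : ℕ => (T : ℝ)⁻¹ *
      (R * ∑' n : ℕ, β ^ n * (1 / c + sqSize (shiftBy ((n : ℤ) + 1) x 0) / c ^ 2)))
      atTop (𝓝 0) := by
    simpa using (tendsto_inv_atTop_nhds_zero_nat (𝕜 := ℝ)).mul_const
      (R * ∑' n : ℕ, β ^ n * (1 / c + sqSize (shiftBy ((n : ℤ) + 1) x 0) / c ^ 2))
  filter_upwards [hx1.eventually_lt_const hm,
    hx2.eventually (Metric.ball_mem_nhds _ (show (0 : ℝ) < ε / 4 by positivity)),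
    hlim.eventually_lt_const (show (0 : ℝ) < ε / 4 by positivity)] with T hT1 hT2 hT3 γ κ h hcl
  rw [Real.dist_eq] at hT2
  have hdiff : |quasiLik i H d T γ κ -
      (T : ℝ)⁻¹ * ∑ t ∈ Finset.Icc 1 T, lossPath i γ' κ' (shiftBy (t : ℤ) x)| ≤
      (T : ℝ)⁻¹ * ∑ t ∈ Finset.Icc 1 T, lossModulus c Q δ (shiftBy (t : ℤ) x) +
      (T : ℝ)⁻¹ *
      (R * ∑' n : ℕ, β ^ n * (1 / c + sqSize (shiftBy ((n : ℤ) + 1) x 0) / c ^ 2)) := by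
    have hT0 : (0 : ℝ) ≤ (T : ℝ)⁻¹ := inv_nonneg.2 T.cast_nonneg
    rw [quasiLik, ← mul_sub, ← mul_add, abs_mul, abs_of_nonneg hT0]
    refine mul_le_mul_of_nonneg_left ?_ hT0
    rw [sum_Icc_one_eq_sum_range, sum_Icc_one_eq_sum_range, sum_Icc_one_eq_sum_range,
      ← Finset.sum_sub_distrib]
    refine (Finset.abs_sum_le_sum_abs _ _).trans
      ((Finset.sum_le_sum fun t _ => hterm γ κ h hcl t).trans ?_)
    rw [Finset.sum_add_distrib, ← Finset.mul_sum]
    gcongr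
    exact hx3.sum_le_tsum _ fun n _ => mul_nonneg (pow_nonneg hβ0 n) (hw0 _)
  rw [abs_lt] at hT2 ⊢
  rw [abs_le] at hdiff
  constructor <;> linarith

end Likelihood

/-! ### Continuity of normalized spectral decompositions. -/

section Spectral

variable {p : ℕ}

lemma transpose_mul_self_of_orthogonal {V : Matrix (Fin p) (Fin p) ℝ}
    (hV : V ∈ Matrix.orthogonalGroup (Fin p) ℝ) : Vᵀ * V = 1 :=
  (Matrix.mem_orthogonalGroup_iff' (Fin p) ℝ).1 hV

lemma mul_transpose_self_of_orthogonal {V : Matrix (Fin p) (Fin p) ℝ}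
    (hV : V ∈ Matrix.orthogonalGroup (Fin p) ℝ) : V * Vᵀ = 1 :=
  (Matrix.mem_orthogonalGroup_iff (Fin p) ℝ).1 hV

lemma isCompact_orthogonalGroup :
    IsCompact {V : Matrix (Fin p) (Fin p) ℝ | V ∈ Matrix.orthogonalGroup (Fin p) ℝ} := by
  have h1 : IsCompact (Set.pi Set.univ fun _ : Fin p =>
      Set.pi Set.univ fun _ : Fin p => Set.Icc (-1 : ℝ) 1) :=
    isCompact_univ_pi fun _ => isCompact_univ_pi fun _ => isCompact_Icc
  have h2 : IsClosed {V : Matrix (Fin p) (Fin p) ℝ | V * Vᵀ = 1} :=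
    isClosed_eq (by fun_prop) continuous_const
  have h3 : {V : Matrix (Fin p) (Fin p) ℝ | V ∈ Matrix.orthogonalGroup (Fin p) ℝ} =
      {V : Matrix (Fin p) (Fin p) ℝ | V * Vᵀ = 1} := by
    ext V
    exact Matrix.mem_orthogonalGroup_iff _ _
  rw [h3]
  refine IsCompact.of_isClosed_subset h1 h2 fun V hV => ?_
  rw [← h3] at hV
  exact fun j _ k _ => abs_le.1 (abs_entry_le_one hV j k)

lemma mul_eq_mul_diagonal_of_eigen {H V : Matrix (Fin p) (Fin p) ℝ} {l : Vec p}
    (h : ∀ j, H *ᵥ Vᵀ j = l j • Vᵀ j) : H * V = V * Matrix.diagonal l := by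
  ext k j
  have := congrFun (h j) k
  rw [Matrix.mul_diagonal]
  simpa [Matrix.mulVec, dotProduct, Matrix.mul_apply, mul_comm] using this

/-- Eigenvectors for simple, ordered eigenvalues are unique up to their signs. -/
lemma eigenvector_eq_or_eq_neg {V₀ V : Matrix (Fin p) (Fin p) ℝ} {l₀ l : Vec p}
    (hV₀ : V₀ ∈ Matrix.orthogonalGroup (Fin p) ℝ) (hV : V ∈ Matrix.orthogonalGroup (Fin p) ℝ)
    (hl₀ : StrictMono l₀) (hl : Monotone l)
    (h : V₀ * Matrix.diagonal l₀ * V₀ᵀ * V = V * Matrix.diagonal l) (j : Fin p) :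
    Vᵀ j = V₀ᵀ j ∨ Vᵀ j = -V₀ᵀ j := by
  -- The orthogonal matrix `V₀ᵀ * V` intertwines the two diagonal matrices. A nonzero entry equates
  -- an entry of `l₀` with one of `l`, so injectivity of `l₀` leaves one nonzero entry per column: a
  -- signed permutation.
  have hQ : Matrix.diagonal l₀ * (V₀ᵀ * V) = (V₀ᵀ * V) * Matrix.diagonal l := by
    have := congrArg (V₀ᵀ * ·) h
    simpa only [← Matrix.mul_assoc, transpose_mul_self_of_orthogonal hV₀, Matrix.one_mul] using this
  have hQQ : (V₀ᵀ * V)ᵀ * (V₀ᵀ * V) = 1 := by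
    rw [Matrix.transpose_mul, Matrix.transpose_transpose, Matrix.mul_assoc, ← Matrix.mul_assoc V₀,
      mul_transpose_self_of_orthogonal hV₀, Matrix.one_mul, transpose_mul_self_of_orthogonal hV]
  have hVQ : V = V₀ * (V₀ᵀ * V) := by
    rw [← Matrix.mul_assoc, mul_transpose_self_of_orthogonal hV₀, Matrix.one_mul]
  generalize V₀ᵀ * V = Q at *
  have hent : ∀ k j, Q k j ≠ 0 → l₀ k = l j := fun k j hkj => by
    have := congrFun (congrFun hQ k) j
    rw [Matrix.diagonal_mul, Matrix.mul_diagonal, mul_comm] at this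
    exact mul_left_cancel₀ hkj this
  have hdot : ∀ j j', ∑ k, Q k j * Q k j' = (1 : Matrix (Fin p) (Fin p) ℝ) j j' := fun j j' => by
    rw [← hQQ]
    rfl
  have hex : ∀ j, ∃ k, Q k j ≠ 0 := fun j => by
    by_contra! hcon
    have := hdot j j
    simp [hcon] at this
  choose σ hσ using hex
  have hzero : ∀ j k, k ≠ σ j → Q k j = 0 := fun j k hk => by
    by_contra hne
    exact hk (hl₀.injective ((hent k j hne).trans (hent _ j (hσ j)).symm))
  have hinj : Function.Injective σ := fun a b hab => by
    by_contra hne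
    have h1 := hdot a b
    rw [Matrix.one_apply_ne hne, Finset.sum_eq_single (σ a)
      (fun k _ hk => by rw [hzero a k hk, zero_mul]) (by simp)] at h1
    have h2 := hσ b
    rw [← hab] at h2
    exact mul_ne_zero (hσ a) h2 h1
  have hmono : StrictMono σ := by
    refine Monotone.strictMono_of_injective (fun a b hab => ?_) hinj
    rw [← hl₀.le_iff_le, hent _ _ (hσ a), hent _ _ (hσ b)]
    exact hl hab
  -- The ordering of both spectra makes the permutation strictly increasing, and an increasing
  -- bijection of `Fin p` is trivial.
  have hid : σ = id := by
    refine (hmono.range_inj strictMono_id).1 ?_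
    rw [(Finite.injective_iff_surjective.1 hinj).range_eq, Set.range_id]
  subst hid
  have hcol : Vᵀ j = Q j j • V₀ᵀ j := by
    funext a
    rw [Matrix.transpose_apply, hVQ, Matrix.mul_apply, Finset.sum_eq_single j
      (fun k _ hk => by rw [hzero j k hk, mul_zero]) (by simp)]
    simp [mul_comm]
  have hsq : Q j j * Q j j = 1 := by
    have h1 := hdot j j
    rwa [Matrix.one_apply_eq, Finset.sum_eq_single j
      (fun k _ hk => by rw [hzero j k hk, zero_mul]) (by simp)] at h1
  rcases mul_self_eq_one_iff.1 hsq with h1 | h1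
  · left; rw [hcol, h1, one_smul]
  · right; rw [hcol, h1, neg_one_smul]

/-- Normalized spectral decompositions are continuous at matrices with simple eigenvalues. -/
theorem tendsto_of_isSpectralDecomp {S : Fin p → Set (Vec p)} (hS : ∀ j, IsSignRule (S j))
    {V₀ : Matrix (Fin p) (Fin p) ℝ} {l₀ : Vec p} (hV₀ : V₀ ∈ Matrix.orthogonalGroup (Fin p) ℝ)
    (hl₀ : StrictMono l₀) (hint : ∀ j, V₀ᵀ j ∈ interior (S j))
    {H : ℕ → Matrix (Fin p) (Fin p) ℝ}
    (hH : Tendsto H atTop (𝓝 (V₀ * Matrix.diagonal l₀ * V₀ᵀ))) {γ : ℕ → Static p}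
    (hγ : ∀ n, IsSpectralDecomp S (H n) (γ n)) : Tendsto γ atTop (𝓝 (l₀, V₀)) := by
  have hcommute : ∀ n, H n * (γ n).2 = (γ n).2 * Matrix.diagonal (γ n).1 := fun n =>
    mul_eq_mul_diagonal_of_eigen (hγ n).eigen
  -- Eigenvalues are continuous functions of `H n` and the eigenvectors, so compactness is needed
  -- for the eigenvectors only.
  have hl : ∀ n j, (γ n).1 j = ((γ n).2ᵀ * (H n * (γ n).2)) j j := fun n j => by
    rw [hcommute, ← Matrix.mul_assoc, transpose_mul_self_of_orthogonal (hγ n).orthogonal,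
      Matrix.one_mul, Matrix.diagonal_apply_eq]
  have hlim : ∀ {F : Filter ℕ} {V : Matrix (Fin p) (Fin p) ℝ}, F ≤ atTop →
      Tendsto (fun n => (γ n).2) F (𝓝 V) → Tendsto (fun n => (γ n).1) F
        (𝓝 fun j => (Vᵀ * (V₀ * Matrix.diagonal l₀ * V₀ᵀ * V)) j j) := by
    intro F V hF hV
    have h1 : Tendsto (fun n => (γ n).2ᵀ * (H n * (γ n).2)) F
        (𝓝 (Vᵀ * (V₀ * Matrix.diagonal l₀ * V₀ᵀ * V))) :=
      ((continuous_id.matrix_transpose.tendsto V).comp hV).mul ((hH.mono_left hF).mul hV)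
    refine tendsto_pi_nhds.2 fun j => ?_
    simp only [hl]
    exact ((continuous_id.matrix_elem j j).tendsto _).comp h1
  have hVlim : Tendsto (fun n => (γ n).2) atTop (𝓝 V₀) := by
    -- Along an ultrafilter converging to a cluster point, the spectral equations and the ordering
    -- pass to the limit, which determines the cluster point up to column signs.
    refine isCompact_orthogonalGroup.tendsto_nhds_of_unique_mapClusterPt
      (Eventually.of_forall fun n => (hγ n).orthogonal) fun V hV hclus => ?_
    obtain ⟨U, hU, hUV⟩ := mapClusterPt_iff_ultrafilter.1 hclus
    have hUl := hlim hU hUV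
    have hmono : Monotone fun j => (Vᵀ * (V₀ * Matrix.diagonal l₀ * V₀ᵀ * V)) j j :=
      fun a b hab => le_of_tendsto_of_tendsto' (tendsto_pi_nhds.1 hUl a)
        (tendsto_pi_nhds.1 hUl b) fun n => (hγ n).monotone hab
    have heq := tendsto_nhds_unique
      (((hH.mono_left hU).mul hUV).congr hcommute)
      (hUV.mul (((Continuous.matrix_diagonal continuous_id).tendsto _).comp hUl))
    have hpm := eigenvector_eq_or_eq_neg hV₀ hV hl₀ hmono heq
    have hcol : ∀ j, Vᵀ j = V₀ᵀ j := by
      intro j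
      -- With the wrong sign, the negated columns would approach an interior point of `S j` and
      -- enter `S j`, which already contains the columns themselves.
      refine (hpm j).resolve_right fun hneg => ?_
      have h1 : Tendsto (fun n => -(γ n).2ᵀ j) U (𝓝 (V₀ᵀ j)) := by
        have h2 : Tendsto (fun n => (γ n).2ᵀ) U (𝓝 Vᵀ) :=
          (continuous_id.matrix_transpose.tendsto V).comp hUV
        have h3 := (tendsto_pi_nhds.1 h2 j).neg
        rwa [hneg, neg_neg] at h3
      obtain ⟨n, hn⟩ := (h1.eventually (mem_interior_iff_mem_nhds.1 (hint j))).exists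
      have h0 : (γ n).2ᵀ j ≠ 0 := fun h0 => by
        have h4 := congrFun (congrFun
          (transpose_mul_self_of_orthogonal (hγ n).orthogonal) j) j
        have h5 : ∀ a, (γ n).2 a j = 0 := fun a => congrFun h0 a
        simp [Matrix.mul_apply, h5] at h4
      rcases hS j _ h0 with h5 | h5
      · exact h5.2 hn
      · exact h5.2 ((hγ n).sign j)
    ext a j
    exact congrFun (hcol j) a
  have hl₀' : (fun j => (V₀ᵀ * (V₀ * Matrix.diagonal l₀ * V₀ᵀ * V₀)) j j) = l₀ := by
    funext j
    rw [Matrix.mul_assoc, transpose_mul_self_of_orthogonal hV₀, Matrix.mul_one,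
      ← Matrix.mul_assoc, transpose_mul_self_of_orthogonal hV₀, Matrix.one_mul,
      Matrix.diagonal_apply_eq]
  have := hlim le_rfl hVlim
  rw [hl₀'] at this
  exact this.prodMk_nhds hVlim

lemma injective_of_hasSimpleEigenvalues {V : Matrix (Fin p) (Fin p) ℝ} {l : Vec p}
    (hV : V ∈ Matrix.orthogonalGroup (Fin p) ℝ)
    (h : HasSimpleEigenvalues (V * Matrix.diagonal l * Vᵀ)) : Function.Injective l := by
  have hchar : (V * Matrix.diagonal l * Vᵀ).charpoly =
      ∏ j, (Polynomial.X - Polynomial.C (l j)) := by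
    rw [Matrix.charpoly_mul_comm, ← Matrix.mul_assoc, transpose_mul_self_of_orthogonal hV,
      Matrix.one_mul, Matrix.charpoly_diagonal]
  intro j k hjk
  by_contra hne
  have hdvd : (Polynomial.X - Polynomial.C (l j)) ^ 2 ∣
      (V * Matrix.diagonal l * Vᵀ).charpoly := by
    rw [hchar, ← Finset.mul_prod_erase _ _ (Finset.mem_univ j),
      ← Finset.mul_prod_erase _ _ (Finset.mem_erase.2 ⟨Ne.symm hne, Finset.mem_univ k⟩), ← hjk,
      ← mul_assoc, ← sq]
    exact dvd_mul_right _ _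
  have hne0 : (V * Matrix.diagonal l * Vᵀ).charpoly ≠ 0 := (Matrix.charpoly_monic _).ne_zero
  have h2 := (Polynomial.le_rootMultiplicity_iff hne0).2 hdvd
  have hroot : (V * Matrix.diagonal l * Vᵀ).charpoly.IsRoot (l j) :=
    (Polynomial.rootMultiplicity_pos hne0).1 (by lia)
  have := h _ hroot
  lia

end Spectral

/-! ### Moments of the process and its covariance matrix. -/

section Model

variable {p : ℕ} {Ω : Type*}

/-- The path of the process at a point of the sample space. -/
def pathOf (X : ℤ → Ω → Vec p) (ω : Ω) : ℤ → Vec p := fun t => X t ω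

lemma eigInf_eq_eigPath (X : ℤ → Ω → Vec p) (i : Fin p) (γ : Static p) (κ : Dynamic p) (t : ℤ)
    (ω : Ω) : eigInf X i γ κ t ω = eigPath i γ κ (shiftBy t (pathOf X ω)) := by
  refine tsum_congr fun n => ?_
  simp only [newsImpact, shiftBy, pathOf]
  rw [show (0 : ℤ) + (-1 - (n : ℤ)) + t = t - 1 - n by ring]

variable [mΩ : MeasurableSpace Ω] {P : Measure Ω}
  {ℱ : Filtration ℤ mΩ} {l₀ : Vec p} {V₀ A₀ : Matrix (Fin p) (Fin p) ℝ} {b₀ : Vec p}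
  {Z X lam : ℤ → Ω → Vec p}

lemma measurable_pathOf (hX : ∀ t, Measurable (X t)) : Measurable (pathOf X) :=
  measurable_pi_lambda _ hX

lemma identDistrib_of_stationary (hse : IsStationaryErgodic P X) (hX : ∀ t, Measurable (X t))
    (t : ℤ) : IdentDistrib (X t) (X 0) P P := by
  refine ⟨(hX t).aemeasurable, (hX 0).aemeasurable, ?_⟩
  have h1 : MeasurePreserving (shiftBy 1) (P.map (pathOf X)) (P.map (pathOf X)) :=
    hse.toMeasurePreserving
  have h2 := (measurePreserving_shiftBy h1 t).map_eq
  have h3 := congrArg (Measure.map fun x : ℤ → Vec p => x 0) h2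
  rw [Measure.map_map (measurable_pi_apply 0) (measurable_shiftBy t),
    Measure.map_map ((measurable_pi_apply 0).comp (measurable_shiftBy t)) (measurable_pathOf hX),
    Measure.map_map (measurable_pi_apply 0) (measurable_pathOf hX)] at h3
  have h4 : ((fun x : ℤ → Vec p => x 0) ∘ shiftBy t) ∘ pathOf X = X t := by
    funext ω
    simp [shiftBy, pathOf]
  rw [h4] at h3
  exact h3

/-- A nonnegative matrix that strictly contracts a positive vector has no nonzero fixed vector. -/
lemma eq_zero_of_subinvariant {A : Matrix (Fin p) (Fin p) ℝ} {b l d : Vec p}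
    (hA : ∀ j k, 0 ≤ A j k) (hb : ∀ j, 0 ≤ b j) (hl : ∀ j, 0 < l j)
    (hsub : ∀ j, ∑ k, A j k * l k + b j * l j < l j)
    (hd : ∀ j, d j = ∑ k, A j k * d k + b j * d j) (j : Fin p) : d j = 0 := by
  have : Nonempty (Fin p) := ⟨j⟩
  -- The maximal ratio `r` is the `l`-weighted sup norm of `d`; evaluating the fixed-point equation
  -- where it is attained contradicts the strict contraction unless `r = 0`.
  obtain ⟨m, hm⟩ := Finite.exists_max fun k => |d k| / l k
  set r := |d m| / l m with hr
  have hr0 : 0 ≤ r := div_nonneg (abs_nonneg _) (hl m).le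
  have hle : ∀ k, |d k| ≤ r * l k := fun k => (div_le_iff₀ (hl k)).1 (hm k)
  have hm1 : |d m| = r * l m := by rw [hr, div_mul_cancel₀ _ (hl m).ne']
  have hbound : |d m| ≤ r * (∑ k, A m k * l k + b m * l m) := by
    conv_lhs => rw [hd m]
    refine (abs_add_le _ _).trans ?_
    rw [mul_add, Finset.mul_sum]
    refine add_le_add ((Finset.abs_sum_le_sum_abs _ _).trans (Finset.sum_le_sum fun k _ => ?_)) ?_
    · rw [abs_mul, abs_of_nonneg (hA m k), mul_left_comm]
      exact mul_le_mul_of_nonneg_left (hle k) (hA m k)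
    · rw [abs_mul, abs_of_nonneg (hb m), mul_left_comm]
      exact mul_le_mul_of_nonneg_left (hle m) (hb m)
  have hr1 : r = 0 := by
    by_contra hne
    have := mul_lt_mul_of_pos_left (hsub m) (lt_of_le_of_ne hr0 (Ne.symm hne))
    linarith
  have := hle j
  rw [hr1, zero_mul] at this
  exact abs_nonpos_iff.1 this

namespace IsLambdaGARCH

lemma ae_rotated (h : IsLambdaGARCH P ℱ l₀ V₀ A₀ b₀ Z X lam) :
    ∀ᵐ ω ∂P, ∀ t j, rotated V₀ (X t ω) j = √(lam t ω j) * Z t ω j := by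
  filter_upwards [h.X_eq] with ω hω t j
  rw [hω t, rotated, Matrix.mulVec_mulVec, transpose_mul_self_of_orthogonal h.orthogonal,
    Matrix.one_mulVec]

lemma indepFun (h : IsLambdaGARCH P ℱ l₀ V₀ A₀ b₀ Z X lam) {t : ℤ} {f : Ω → ℝ}
    (hf : Measurable[ℱ (t - 1)] f) {φ : Vec p → ℝ} (hφ : Measurable φ) :
    IndepFun f (fun ω => φ (Z t ω)) P := by
  have h1 : Indep (MeasurableSpace.comap f inferInstance)
      (MeasurableSpace.comap (fun ω => φ (Z t ω)) inferInstance) P := by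
    refine indep_of_indep_of_le_left (indep_of_indep_of_le_right (h.Z_indep t).symm ?_)
      hf.comap_le
    rw [show (fun ω => φ (Z t ω)) = φ ∘ Z t from rfl, ← MeasurableSpace.comap_comp]
    exact MeasurableSpace.comap_mono hφ.comap_le
  exact h1

lemma measurable_Z (h : IsLambdaGARCH P ℱ l₀ V₀ A₀ b₀ Z X lam) (t : ℤ) : Measurable (Z t) :=
  (h.Z_adapted t).mono (ℱ.le t) le_rfl

lemma measurable_lam_apply (h : IsLambdaGARCH P ℱ l₀ V₀ A₀ b₀ Z X lam) (t : ℤ) (j : Fin p) :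
    Measurable[ℱ (t - 1)] fun ω => lam t ω j :=
  (measurable_pi_apply j).comp (h.lam_predictable t)

lemma not_Z_sq_ae_zero (h : IsLambdaGARCH P ℱ l₀ V₀ A₀ b₀ Z X lam) (t : ℤ) (j : Fin p) :
    ¬ (fun ω => Z t ω j ^ 2) =ᵐ[P] 0 := fun h0 => by
  have h1 := h.Z_cov t j j
  rw [if_pos rfl, integral_eq_zero_of_ae] at h1
  · exact zero_ne_one h1
  · filter_upwards [h0] with ω hω
    rw [← sq]
    exact hω

/-- Predictable factors separate from squared innovations. -/
lemma integrable_and_integral_mul_sq (h : IsLambdaGARCH P ℱ l₀ V₀ A₀ b₀ Z X lam) {t : ℤ}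
    {f : Ω → ℝ} (hf : Measurable[ℱ (t - 1)] f) (j : Fin p)
    (hi : Integrable (fun ω => f ω * Z t ω j ^ 2) P) :
    Integrable f P ∧ ∫ ω, f ω * Z t ω j ^ 2 ∂P = ∫ ω, f ω ∂P := by
  have hind : IndepFun f (fun ω => Z t ω j ^ 2) P :=
    h.indepFun hf (φ := fun z => z j ^ 2) ((measurable_pi_apply j).pow_const 2)
  have hfm : AEStronglyMeasurable f P := (hf.mono (ℱ.le _) le_rfl).aestronglyMeasurable
  have hZm : AEStronglyMeasurable (fun ω => Z t ω j ^ 2) P :=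
    (((measurable_pi_apply j).comp (h.measurable_Z t)).pow_const 2).aestronglyMeasurable
  -- Integrability of the predictable factor is deduced from that of the product: the factors are
  -- independent and the squared innovation is not almost surely zero.
  refine ⟨hind.integrable_left_of_integrable_op (· * ·) 1 one_ne_zero
    (fun x y => by simp [enorm_mul]) hi hfm hZm (h.not_Z_sq_ae_zero t j), ?_⟩
  rw [hind.integral_fun_mul_eq_mul_integral hfm hZm]
  have := h.Z_cov t j j
  rw [if_pos rfl] at this
  simp only [← sq] at this
  rw [this, mul_one]

lemma memLp_rotated (hmom : ∀ t j, MemLp (fun ω => X t ω j) 2 P)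
    (V : Matrix (Fin p) (Fin p) ℝ) (t : ℤ) (j : Fin p) :
    MemLp (fun ω => rotated V (X t ω) j) 2 P := by
  simp only [rotated, Matrix.mulVec, dotProduct]
  exact memLp_finsetSum _ fun k _ => (hmom t k).const_mul _

/-- Moments are assumed for `X` alone; they pass to `lam` because the squared rotated return is
`lam` times an independent squared innovation of mean `1`. -/
lemma integrable_lam_and_integral_eq (h : IsLambdaGARCH P ℱ l₀ V₀ A₀ b₀ Z X lam)
    (hmom : ∀ t j, MemLp (fun ω => X t ω j) 2 P) (t : ℤ) (j : Fin p) :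
    Integrable (fun ω => lam t ω j) P ∧
      ∫ ω, rotated V₀ (X t ω) j ^ 2 ∂P = ∫ ω, lam t ω j ∂P := by
  have hae : (fun ω => rotated V₀ (X t ω) j ^ 2) =ᵐ[P] fun ω => lam t ω j * Z t ω j ^ 2 := by
    filter_upwards [h.ae_rotated, h.lam_pos] with ω h1 h2
    rw [h1, mul_pow, Real.sq_sqrt (h2 t j).le]
  have hi : Integrable (fun ω => lam t ω j * Z t ω j ^ 2) P :=
    (memLp_rotated hmom V₀ t j).integrable_sq.congr hae
  rw [integral_congr_ae hae]
  exact h.integrable_and_integral_mul_sq (h.measurable_lam_apply t j) j hi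

lemma integral_rotated_mul_rotated (h : IsLambdaGARCH P ℱ l₀ V₀ A₀ b₀ Z X lam) (t : ℤ)
    {j k : Fin p} (hjk : j ≠ k) : ∫ ω, rotated V₀ (X t ω) j * rotated V₀ (X t ω) k ∂P = 0 := by
  have hae : (fun ω => rotated V₀ (X t ω) j * rotated V₀ (X t ω) k) =ᵐ[P]
      fun ω => (√(lam t ω j) * √(lam t ω k)) * (Z t ω j * Z t ω k) := by
    filter_upwards [h.ae_rotated] with ω h1
    rw [h1, h1]
    ring
  have hf : Measurable[ℱ (t - 1)] fun ω => √(lam t ω j) * √(lam t ω k) :=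
    (h.measurable_lam_apply t j).sqrt.mul (h.measurable_lam_apply t k).sqrt
  have hφ : Measurable fun z : Vec p => z j * z k :=
    (measurable_pi_apply j).mul (measurable_pi_apply k)
  rw [integral_congr_ae hae, (h.indepFun hf hφ).integral_fun_mul_eq_mul_integral
    (hf.mono (ℱ.le _) le_rfl).aestronglyMeasurable
    (hφ.comp (h.measurable_Z t)).aestronglyMeasurable, h.Z_cov t j k, if_neg hjk, mul_zero]

variable [IsProbabilityMeasure P]

/-- The stationary mean of the conditional eigenvalues is the vector of unconditional ones. -/
lemma integral_lam (h : IsLambdaGARCH P ℱ l₀ V₀ A₀ b₀ Z X lam) (hse : IsStationaryErgodic P X)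
    (hmom : ∀ t j, MemLp (fun ω => X t ω j) 2 P) (t : ℤ) (j : Fin p) :
    ∫ ω, lam t ω j ∂P = l₀ j := by
  -- Stationarity is assumed for `X`, not for `lam`; the mean of `lam` inherits it from the squared
  -- rotated returns.
  have hstat : ∀ t k, ∫ ω, lam t ω k ∂P = ∫ ω, lam 0 ω k ∂P := fun t k => by
    rw [← (h.integrable_lam_and_integral_eq hmom t k).2,
      ← (h.integrable_lam_and_integral_eq hmom 0 k).2]
    exact ((identDistrib_of_stationary hse h.X_measurable t).comp
      ((measurable_rotated V₀ k).pow_const 2)).integral_eq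
  have hrec : ∀ k, ∫ ω, lam 0 ω k ∂P = intercept k l₀ (A₀ k, b₀ k) +
      ∑ m, A₀ k m * ∫ ω, lam 0 ω m ∂P + b₀ k * ∫ ω, lam 0 ω k ∂P := fun k => by
    have h1 : (fun ω => lam 0 ω k) =ᵐ[P] fun ω => intercept k l₀ (A₀ k, b₀ k)
        + ∑ m, A₀ k m * rotated V₀ (X (0 - 1) ω) m ^ 2 + b₀ k * lam (0 - 1) ω k := by
      filter_upwards [h.lam_eq] with ω hω
      exact hω 0 k
    have hsq : ∀ m, Integrable (fun ω => A₀ k m * rotated V₀ (X (0 - 1) ω) m ^ 2) P := fun m =>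
      (memLp_rotated hmom V₀ _ m).integrable_sq.const_mul _
    have hsum : Integrable (fun ω => ∑ m, A₀ k m * rotated V₀ (X (0 - 1) ω) m ^ 2) P :=
      integrable_finsetSum _ fun m _ => hsq m
    have hforce : Integrable (fun ω => intercept k l₀ (A₀ k, b₀ k) +
        ∑ m, A₀ k m * rotated V₀ (X (0 - 1) ω) m ^ 2) P := (integrable_const _).add hsum
    refine (integral_congr_ae h1).trans ?_
    rw [integral_add hforce ((h.integrable_lam_and_integral_eq hmom _ k).1.const_mul _),
      integral_add (integrable_const _) hsum, integral_finsetSum _ fun m _ => hsq m,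
      integral_const_mul, hstat]
    simp only [integral_const_mul, (h.integrable_lam_and_integral_eq hmom _ _).2, hstat]
    simp
  -- By the definition of the intercept, `l₀` solves the same equation, so the difference solves the
  -- homogeneous one.
  rw [hstat, ← sub_eq_zero]
  refine eq_zero_of_subinvariant (d := fun k => ∫ ω, lam 0 ω k ∂P - l₀ k) h.A_nonneg h.b_nonneg
    h.eigenvalue_pos (fun k => ?_) (fun k => ?_) j
  · have := h.intercept_pos k
    rw [intercept] at this
    dsimp only at this
    linarith
  · have h1 := hrec k
    rw [intercept] at h1
    dsimp only at h1
    simp only [mul_sub, Finset.sum_sub_distrib]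
    linarith

lemma uncondCov_eq (h : IsLambdaGARCH P ℱ l₀ V₀ A₀ b₀ Z X lam) (hse : IsStationaryErgodic P X)
    (hmom : ∀ t j, MemLp (fun ω => X t ω j) 2 P) :
    uncondCov P X = V₀ * Matrix.diagonal l₀ * V₀ᵀ := by
  have h1 : V₀ᵀ * uncondCov P X * V₀ = Matrix.diagonal l₀ := by
    ext j k
    have h2 : (V₀ᵀ * uncondCov P X * V₀) j k =
        ∫ ω, rotated V₀ (X 0 ω) j * rotated V₀ (X 0 ω) k ∂P := by
      have hi : ∀ a b, Integrable (fun ω => V₀ a j * X 0 ω a * (V₀ b k * X 0 ω b)) P :=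
        fun a b => ((hmom 0 a).const_mul _).integrable_mul ((hmom 0 b).const_mul _)
      simp only [rotated, Matrix.mulVec, dotProduct, Matrix.transpose_apply,
        Finset.sum_mul_sum]
      rw [integral_finsetSum _ fun a _ => integrable_finsetSum _ fun b _ => hi a b]
      simp only [integral_finsetSum _ fun b _ => hi _ b]
      simp only [Matrix.mul_apply, Matrix.transpose_apply, uncondCov, Matrix.of_apply,
        Finset.sum_mul]
      rw [Finset.sum_comm]
      refine Finset.sum_congr rfl fun a _ => Finset.sum_congr rfl fun b _ => ?_
      rw [mul_right_comm, ← integral_const_mul]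
      congr 1
      funext ω
      ring
    rw [h2]
    by_cases hjk : j = k
    · subst hjk
      simp only [← sq]
      rw [(h.integrable_lam_and_integral_eq hmom 0 j).2, h.integral_lam hse hmom,
        Matrix.diagonal_apply_eq]
    · rw [h.integral_rotated_mul_rotated 0 hjk, Matrix.diagonal_apply_ne _ hjk]
  rw [← h1]
  simp only [← Matrix.mul_assoc]
  rw [mul_transpose_self_of_orthogonal h.orthogonal, Matrix.one_mul, Matrix.mul_assoc,
    mul_transpose_self_of_orthogonal h.orthogonal, Matrix.mul_one]

end IsLambdaGARCH

end Model

/-! ### The expected quasi-likelihood and its unique minimizer. -/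

section Identification

lemma measurable_mulVec_sqrt_mul {p : ℕ} {Ω : Type*} {m : MeasurableSpace Ω}
    (V : Matrix (Fin p) (Fin p) ℝ) {f g : Ω → Vec p} (hf : Measurable f) (hg : Measurable g) :
    Measurable fun ω => V *ᵥ fun j => √(f ω j) * g ω j := by
  refine measurable_pi_lambda _ fun k => ?_
  simp only [Matrix.mulVec, dotProduct]
  fun_prop

lemma measurable_eigPath_of_past {p : ℕ} {Ω : Type*} {m : MeasurableSpace Ω} (i : Fin p)
    (γ : Static p) (κ : Dynamic p) {Y : ℤ → Ω → Vec p} {t : ℤ}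
    (hY : ∀ s < t, Measurable (Y s)) :
    Measurable fun ω => eigPath i γ κ (shiftBy t fun s => Y s ω) := by
  unfold eigPath past
  exact Measurable.tsum fun n => Measurable.const_mul
    ((measurable_newsImpact i γ κ).comp (hY _ (by lia))) _

variable {p : ℕ} {Ω : Type*} [mΩ : MeasurableSpace Ω] {P : Measure Ω}
  {ℱ : Filtration ℤ mΩ} {l₀ : Vec p} {V₀ A₀ : Matrix (Fin p) (Fin p) ℝ} {b₀ : Vec p}
  {Z X lam : ℤ → Ω → Vec p} {i : Fin p} {c A B β : ℝ} {κ : Dynamic p}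

namespace IsLambdaGARCH

/-- The stationary conditional eigenvalues have predictable versions. -/
lemma exists_predictable_eigPath (h : IsLambdaGARCH P ℱ l₀ V₀ A₀ b₀ Z X lam) (i : Fin p)
    (γ : Static p) (κ : Dynamic p) (t : ℤ) :
    ∃ f : Ω → ℝ, Measurable[ℱ (t - 1)] f ∧
      ∀ᵐ ω ∂P, eigPath i γ κ (shiftBy t (pathOf X ω)) = f ω := by
  have hmeas : ∀ s, Measurable[ℱ s] fun ω => V₀ *ᵥ fun j => √(lam s ω j) * Z s ω j := fun s =>
    measurable_mulVec_sqrt_mul V₀ ((h.lam_predictable s).mono (ℱ.mono (by lia)) le_rfl)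
      (h.Z_adapted s)
  -- `X` itself is not assumed adapted; it is replaced by the right-hand side of the model equation,
  -- which is adapted and almost surely equal to it.
  refine ⟨fun ω => eigPath i γ κ (shiftBy t fun s => V₀ *ᵥ fun j => √(lam s ω j) * Z s ω j),
    ?_, ?_⟩
  · exact measurable_eigPath_of_past i γ κ fun s hs => (hmeas s).mono (ℱ.mono (by lia)) le_rfl
  · filter_upwards [h.X_eq] with ω hω
    congr 2
    funext s
    exact hω s

variable [IsProbabilityMeasure P]

/-- The true conditional eigenvalue is the stationary solution of its recursion. -/
lemma ae_lam_eq_eigPath (h : IsLambdaGARCH P ℱ l₀ V₀ A₀ b₀ Z X lam)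
    (hse : IsStationaryErgodic P X) (hmom : ∀ t j, MemLp (fun ω => X t ω j) 2 P)
    (hN : Integrable (fun x => sqSize (x 0)) (P.map (pathOf X)))
    (hc : 0 ≤ c) (hβ : β < 1) (h₀ : IsAdmissible i c A B β (l₀, V₀) (A₀ i, b₀ i)) (t : ℤ) :
    ∀ᵐ ω ∂P, lam t ω i = eigPath i (l₀, V₀) (A₀ i, b₀ i) (shiftBy t (pathOf X ω)) := by
  have hpath := measurable_pathOf h.X_measurable
  have : IsProbabilityMeasure (P.map (pathOf X)) :=
    Measure.isProbabilityMeasure_map hpath.aemeasurable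
  have hν : MeasurePreserving (shiftBy 1) (P.map (pathOf X)) (P.map (pathOf X)) :=
    hse.toMeasurePreserving
  set s : (ℤ → Vec p) → ℝ := eigPath i (l₀, V₀) (A₀ i, b₀ i) with hs
  have hsi : Integrable s (P.map (pathOf X)) := h₀.integrable_eigPath hc hβ hν hN
  have hst : ∀ t, Integrable (fun ω => s (shiftBy t (pathOf X ω))) P ∧
      ∫ ω, s (shiftBy t (pathOf X ω)) ∂P = ∫ x, s x ∂(P.map (pathOf X)) := fun t => by
    have h1 := measurePreserving_shiftBy hν t
    have h2 : MeasurePreserving (fun ω => shiftBy t (pathOf X ω)) P (P.map (pathOf X)) :=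
      ⟨(measurable_shiftBy t).comp hpath, by
        rw [← h1.map_eq, Measure.map_map (measurable_shiftBy t) hpath]; rfl⟩
    refine ⟨h2.integrable_comp_of_integrable hsi, ?_⟩
    rw [← h2.map_eq, integral_map h2.measurable.aemeasurable]
    rw [h2.map_eq]
    exact hsi.aestronglyMeasurable
  have hdi : ∀ t, Integrable (fun ω => lam t ω i - s (shiftBy t (pathOf X ω))) P := fun t =>
    (h.integrable_lam_and_integral_eq hmom t i).1.sub (hst t).1
  -- Both solutions have the same forcing, so their mean distance shrinks by `b₀ i < 1` per step. As
  -- it is bounded uniformly in time, going back arbitrarily far shows that it is zero.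
  have hrec : ∀ t, ∫ ω, |lam (t + 1) ω i - s (shiftBy (t + 1) (pathOf X ω))| ∂P =
      b₀ i * ∫ ω, |lam t ω i - s (shiftBy t (pathOf X ω))| ∂P := fun t => by
    rw [← integral_const_mul]
    refine integral_congr_ae ?_
    filter_upwards [h.lam_eq,
      ae_of_ae_map hpath.aemeasurable (h₀.ae_eigPath_shiftBy hc hβ hν hN)] with ω h1 h2
    have h3 := h1 (t + 1) i
    rw [add_sub_cancel_right] at h3
    have h4 : lam (t + 1) ω i - s (shiftBy (t + 1) (pathOf X ω)) =
        b₀ i * (lam t ω i - s (shiftBy t (pathOf X ω))) := by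
      rw [hs, h2 t, h3, newsImpact]
      simp only [pathOf]
      ring
    rw [h4, abs_mul, abs_of_nonneg (h.b_nonneg i)]
  have hbound : ∀ t, ∫ ω, |lam t ω i - s (shiftBy t (pathOf X ω))| ∂P ≤
      l₀ i + ∫ x, s x ∂(P.map (pathOf X)) := fun t => by
    rw [← h.integral_lam hse hmom t i, ← (hst t).2,
      ← integral_add (h.integrable_lam_and_integral_eq hmom t i).1 (hst t).1]
    refine integral_mono_ae (hdi t).abs
      ((h.integrable_lam_and_integral_eq hmom t i).1.add (hst t).1) ?_
    filter_upwards [h.lam_pos] with ω hω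
    have h1 := hω t i
    have h2 : 0 ≤ s (shiftBy t (pathOf X ω)) := h₀.eigPath_nonneg hc _
    rw [abs_le]
    constructor <;> linarith
  have hiter : ∀ (n : ℕ) (t : ℤ), ∫ ω, |lam t ω i - s (shiftBy t (pathOf X ω))| ∂P ≤
      b₀ i ^ n * (l₀ i + ∫ x, s x ∂(P.map (pathOf X))) := fun n => by
    induction n with
    | zero => intro t; simpa using hbound t
    | succ n ih =>
      intro t
      have h1 := hrec (t - 1)
      rw [sub_add_cancel] at h1
      rw [h1, pow_succ', mul_assoc]
      exact mul_le_mul_of_nonneg_left (ih _) (h.b_nonneg i)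
  have hzero : ∫ ω, |lam t ω i - s (shiftBy t (pathOf X ω))| ∂P = 0 := by
    refine le_antisymm ?_ (integral_nonneg fun _ => abs_nonneg _)
    have hlim := (tendsto_pow_atTop_nhds_zero_of_lt_one (h.b_nonneg i)
      (h₀.b_le.trans_lt hβ)).mul_const (l₀ i + ∫ x, s x ∂(P.map (pathOf X)))
    rw [zero_mul] at hlim
    exact ge_of_tendsto' hlim fun n => hiter n t
  rw [integral_eq_zero_iff_of_nonneg (fun _ => abs_nonneg _) (hdi t).abs] at hzero
  filter_upwards [hzero] with ω hω
  exact sub_eq_zero.1 (abs_eq_zero.1 hω)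

/-- The expected quasi-likelihood of an equation is uniquely minimized at its true parameter. -/
lemma integral_lossPath_lt (h : IsLambdaGARCH P ℱ l₀ V₀ A₀ b₀ Z X lam)
    (hse : IsStationaryErgodic P X) (hmom : ∀ t j, MemLp (fun ω => X t ω j) 2 P)
    (hN : Integrable (fun x => sqSize (x 0)) (P.map (pathOf X)))
    (hc : 0 < c) (hβ : β < 1) (h₀ : IsAdmissible i c A B β (l₀, V₀) (A₀ i, b₀ i))
    (h₁ : IsAdmissible i c A B β (l₀, V₀) κ)
    (hne : ¬ eigInf X i (l₀, V₀) κ 0 =ᵐ[P] eigInf X i (l₀, V₀) (A₀ i, b₀ i) 0) :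
    ∫ x, lossPath i (l₀, V₀) (A₀ i, b₀ i) x ∂(P.map (pathOf X)) <
      ∫ x, lossPath i (l₀, V₀) κ x ∂(P.map (pathOf X)) := by
  have hpath := measurable_pathOf h.X_measurable
  have : IsProbabilityMeasure (P.map (pathOf X)) :=
    Measure.isProbabilityMeasure_map hpath.aemeasurable
  have hν : MeasurePreserving (shiftBy 1) (P.map (pathOf X)) (P.map (pathOf X)) :=
    hse.toMeasurePreserving
  have hmp : MeasurePreserving (pathOf X) P (P.map (pathOf X)) := ⟨hpath, rfl⟩
  have hpos : ∀ {κ}, IsAdmissible i c A B β (l₀, V₀) κ →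
      ∀ᵐ ω ∂P, 0 < eigPath i (l₀, V₀) κ (pathOf X ω) := fun hκ => by
    filter_upwards [ae_of_ae_map hpath.aemeasurable (hκ.ae_le_eigPath hc.le hβ hν hN)] with ω hω
    have := hω 0
    rw [shiftBy_zero] at this
    exact hc.trans_le this
  have hlam : ∀ᵐ ω ∂P, lam 0 ω i = eigPath i (l₀, V₀) (A₀ i, b₀ i) (pathOf X ω) := by
    filter_upwards [h.ae_lam_eq_eigPath hse hmom hN hc.le hβ h₀ 0] with ω hω
    rw [hω, shiftBy_zero]
  -- Separating the innovation from the predictable quotient replaces the squared return in the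
  -- expected loss by `lam`.
  have hsplit : ∀ {κ}, IsAdmissible i c A B β (l₀, V₀) κ →
      Integrable (fun ω => Real.log (eigPath i (l₀, V₀) κ (pathOf X ω))) P ∧
      Integrable (fun ω => lam 0 ω i / eigPath i (l₀, V₀) κ (pathOf X ω)) P ∧
      ∫ x, lossPath i (l₀, V₀) κ x ∂(P.map (pathOf X)) =
        ∫ ω, Real.log (eigPath i (l₀, V₀) κ (pathOf X ω)) ∂P +
        ∫ ω, lam 0 ω i / eigPath i (l₀, V₀) κ (pathOf X ω) ∂P := by
    intro κ hκ
    have hlog : Integrable (fun ω => Real.log (eigPath i (l₀, V₀) κ (pathOf X ω))) P :=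
      hmp.integrable_comp_of_integrable (hκ.integrable_log_eigPath hc hβ hν hN)
    have hdiv : Integrable (fun ω => rotated V₀ (X 0 ω) i ^ 2 /
        eigPath i (l₀, V₀) κ (pathOf X ω)) P :=
      hmp.integrable_comp_of_integrable (hκ.integrable_rotated_sq_div hc hβ hν hN)
    obtain ⟨f, hfm, hf⟩ := h.exists_predictable_eigPath i (l₀, V₀) κ 0
    have hquot : (fun ω => lam 0 ω i / f ω) =ᵐ[P]
        fun ω => lam 0 ω i / eigPath i (l₀, V₀) κ (pathOf X ω) := by
      filter_upwards [hf] with ω hω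
      rw [← hω, shiftBy_zero]
    have hae : (fun ω => rotated V₀ (X 0 ω) i ^ 2 / eigPath i (l₀, V₀) κ (pathOf X ω)) =ᵐ[P]
        fun ω => lam 0 ω i / f ω * Z 0 ω i ^ 2 := by
      filter_upwards [h.ae_rotated, h.lam_pos, hf] with ω h1 h2 h3
      rw [← h3, shiftBy_zero, h1, mul_pow, Real.sq_sqrt (h2 0 i).le]
      ring
    have hsep := h.integrable_and_integral_mul_sq ((h.measurable_lam_apply 0 i).div hfm) i
      (hdiv.congr hae)
    refine ⟨hlog, hsep.1.congr hquot, ?_⟩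
    rw [integral_map hpath.aemeasurable (measurable_lossPath _ _ _).aestronglyMeasurable]
    refine (integral_add hlog hdiv).trans ?_
    rw [integral_congr_ae hae, ← integral_congr_ae hquot]
    congr 1
    exact hsep.2
  obtain ⟨hl0, hq0, he0⟩ := hsplit h₀
  obtain ⟨hl1, hq1, he1⟩ := hsplit h₁
  have hone : ∫ ω, lam 0 ω i / eigPath i (l₀, V₀) (A₀ i, b₀ i) (pathOf X ω) ∂P = 1 := by
    have : (fun ω => lam 0 ω i / eigPath i (l₀, V₀) (A₀ i, b₀ i) (pathOf X ω)) =ᵐ[P]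
        fun _ => 1 := by
      filter_upwards [hlam, hpos h₀] with ω h1 h2
      rw [h1, div_self h2.ne']
    rw [integral_congr_ae this]
    simp
  rw [he0, he1, hone]
  have hli : Integrable (fun ω => Real.log (eigPath i (l₀, V₀) κ (pathOf X ω)) -
      Real.log (eigPath i (l₀, V₀) (A₀ i, b₀ i) (pathOf X ω))) P := hl1.sub hl0
  have hqi : Integrable (fun ω => lam 0 ω i / eigPath i (l₀, V₀) κ (pathOf X ω) - 1) P :=
    hq1.sub (integrable_const 1)
  have hgi : Integrable (fun ω => (Real.log (eigPath i (l₀, V₀) κ (pathOf X ω)) -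
      Real.log (eigPath i (l₀, V₀) (A₀ i, b₀ i) (pathOf X ω))) +
      (lam 0 ω i / eigPath i (l₀, V₀) κ (pathOf X ω) - 1)) P :=
    hli.add hqi
  -- The excess loss is the mean of `ρ - 1 - log ρ`, where `ρ` is the true eigenvalue divided by the
  -- one at `κ`. This is nonnegative and vanishes only at `ρ = 1`.
  have hgap : ∫ ω, ((Real.log (eigPath i (l₀, V₀) κ (pathOf X ω)) -
      Real.log (eigPath i (l₀, V₀) (A₀ i, b₀ i) (pathOf X ω))) +
      (lam 0 ω i / eigPath i (l₀, V₀) κ (pathOf X ω) - 1)) ∂P =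
      (∫ ω, Real.log (eigPath i (l₀, V₀) κ (pathOf X ω)) ∂P -
      ∫ ω, Real.log (eigPath i (l₀, V₀) (A₀ i, b₀ i) (pathOf X ω)) ∂P) +
      (∫ ω, lam 0 ω i / eigPath i (l₀, V₀) κ (pathOf X ω) ∂P - 1) := by
    rw [integral_add hli hqi, integral_sub hl1 hl0,
      integral_sub hq1 (integrable_const 1)]
    simp
  have hlogdiv : ∀ᵐ ω ∂P, Real.log (eigPath i (l₀, V₀) κ (pathOf X ω)) -
      Real.log (eigPath i (l₀, V₀) (A₀ i, b₀ i) (pathOf X ω)) =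
      -Real.log (lam 0 ω i / eigPath i (l₀, V₀) κ (pathOf X ω)) := by
    filter_upwards [hlam, hpos h₀, hpos h₁] with ω h1 h2 h3
    rw [h1, Real.log_div h2.ne' h3.ne']
    ring
  have hg0 : 0 ≤ᵐ[P] fun ω => (Real.log (eigPath i (l₀, V₀) κ (pathOf X ω)) -
      Real.log (eigPath i (l₀, V₀) (A₀ i, b₀ i) (pathOf X ω))) +
      (lam 0 ω i / eigPath i (l₀, V₀) κ (pathOf X ω) - 1) := by
    filter_upwards [hlogdiv, hpos h₁, h.lam_pos] with ω h1 h2 h3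
    rw [h1, Pi.zero_apply]
    linarith [Real.log_le_sub_one_of_pos (div_pos (h3 0 i) h2)]
  by_contra hcon
  refine hne ?_
  have hg := (integral_eq_zero_iff_of_nonneg_ae hg0 hgi).1
    (le_antisymm (by rw [hgap]; linarith) (integral_nonneg_of_ae hg0))
  filter_upwards [hg, hlogdiv, hpos h₁, hlam, h.lam_pos] with ω h1 h2 h3 h4 h5
  rw [eigInf_eq_eigPath, eigInf_eq_eigPath, shiftBy_zero, ← h4]
  rw [h2, Pi.zero_apply] at h1
  by_contra hdiff
  have h6 : lam 0 ω i / eigPath i (l₀, V₀) κ (pathOf X ω) ≠ 1 := fun h7 =>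
    hdiff ((div_eq_one_iff_eq h3.ne').1 h7).symm
  linarith [Real.log_lt_sub_one_of_pos (div_pos (h5 0 i) h3) h6]

end IsLambdaGARCH

end Identification

/-! ### Uniform bounds near the truth, and existence and convergence of minimizers. -/

section Estimator

variable {p : ℕ} {i : Fin p}

/-- Parameters whose unconditional eigenvalues are close to the true ones are uniformly
admissible. -/
lemma exists_isAdmissible {L : Set (Vec p)} {V : Set (Matrix (Fin p) (Fin p) ℝ)}
    {K : Set (Dynamic p)} (hΘ : IsParameterSpace i L V K) (hK : IsCompact K) (hne : K.Nonempty)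
    {l₀ : Vec p} (hl₀ : l₀ ∈ L) : ∃ c A B β r : ℝ, 0 < c ∧ β < 1 ∧ 0 < r ∧
      ∀ γ : Static p, γ.2 ∈ Matrix.orthogonalGroup (Fin p) ℝ → (∀ j, |γ.1 j - l₀ j| ≤ r) →
        ∀ κ ∈ K, IsAdmissible i c A B β γ κ := by
  have hcont : Continuous fun κ : Dynamic p => intercept i l₀ κ := by
    unfold intercept
    fun_prop
  obtain ⟨κm, hκm, hmin⟩ := hK.exists_isMinOn hne hcont.continuousOn
  set c₀ := intercept i l₀ κm with hc₀
  have hc₀pos : 0 < c₀ := hΘ.intercept_pos l₀ hl₀ κm hκm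
  obtain ⟨A, hA⟩ := hK.isBounded.exists_norm_le
  have hApos : 0 ≤ A := (norm_nonneg _).trans (hA κm hκm)
  have hli : 0 < l₀ i := hΘ.eigenvalue_pos l₀ hl₀ i
  have ha : ∀ κ ∈ K, ∀ j, κ.1 j ≤ A := fun κ hκ j =>
    (le_abs_self _).trans ((norm_le_pi_norm κ.1 j).trans ((norm_fst_le κ).trans (hA κ hκ)))
  -- Nonnegative `a` gives `c₀ ≤ (1 - b) * l₀ i`: a positive minimal intercept keeps `b` uniformly
  -- below one.
  have hb : ∀ κ ∈ K, κ.2 ≤ 1 - c₀ / l₀ i := fun κ hκ => by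
    have h1 : c₀ ≤ intercept i l₀ κ := hmin hκ
    have h2 : 0 ≤ ∑ j, κ.1 j * l₀ j := Finset.sum_nonneg fun j _ =>
      mul_nonneg (hΘ.a_nonneg κ hκ j) (hΘ.eigenvalue_pos l₀ hl₀ j).le
    have h3 : c₀ / l₀ i ≤ 1 - κ.2 := by
      rw [div_le_iff₀ hli]
      rw [intercept] at h1
      linarith
    linarith
  have hden : 0 < 2 * (1 + p * A) := by positivity
  -- Moving each eigenvalue by at most `r` moves the intercept by at most `r * (1 + p * A)`, so this
  -- radius costs at most half of `c₀`.
  refine ⟨c₀ / 2, A, ‖l₀‖ + 1, 1 - c₀ / l₀ i, min 1 (c₀ / (2 * (1 + p * A))), half_pos hc₀pos,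
    sub_lt_self _ (div_pos hc₀pos hli), lt_min one_pos (div_pos hc₀pos hden), ?_⟩
  intro γ hγ hclose κ hκ
  refine ⟨hγ, fun j => ?_, hΘ.a_nonneg κ hκ, ha κ hκ, hΘ.b_nonneg κ hκ, hb κ hκ, ?_⟩
  · have h1 := (hclose j).trans (min_le_left _ _)
    have h2 : |l₀ j| ≤ ‖l₀‖ := norm_le_pi_norm l₀ j
    rw [abs_le] at *
    constructor <;> linarith
  · have hr := fun j => (hclose j).trans (min_le_right _ _)
    set r := c₀ / (2 * (1 + p * A)) with hrdef
    have hr0 : 0 ≤ r := (abs_nonneg _).trans (hr i)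
    have h1 : |(1 - κ.2) * (γ.1 i - l₀ i)| ≤ 1 * r := by
      rw [abs_mul]
      refine mul_le_mul ?_ (hr i) (abs_nonneg _) zero_le_one
      have := hΘ.b_nonneg κ hκ
      have := hb κ hκ
      have := div_pos hc₀pos hli
      rw [abs_le]
      constructor <;> linarith
    have h2 : |∑ j, κ.1 j * (γ.1 j - l₀ j)| ≤ p * (A * r) := sum_abs_le_card_mul fun j => by
      rw [abs_mul, abs_of_nonneg (hΘ.a_nonneg κ hκ j)]
      exact mul_le_mul (ha κ hκ j) (hr j) (abs_nonneg _) hApos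
    have h3 : intercept i γ.1 κ = intercept i l₀ κ + (1 - κ.2) * (γ.1 i - l₀ i) -
        ∑ j, κ.1 j * (γ.1 j - l₀ j) := by
      simp only [intercept, mul_sub, Finset.sum_sub_distrib]
      ring
    have h4 : r * (1 + p * A) = c₀ / 2 := by
      rw [hrdef]
      field_simp
    have h5 : c₀ ≤ intercept i l₀ κ := hmin hκ
    rw [abs_le] at h1 h2
    rw [h3]
    linarith

lemma continuous_eigFilter (i : Fin p) (H : Matrix (Fin p) (Fin p) ℝ) (x : ℕ → Vec p)
    (γ : Static p) (t : ℕ) : Continuous fun κ : Dynamic p => eigFilter i H x γ κ t := by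
  induction t with
  | zero => exact continuous_const
  | succ t ih =>
    simp only [eigFilter, intercept]
    fun_prop

lemma continuousOn_quasiLik {c A B β : ℝ} (hc : 0 < c) {H : Matrix (Fin p) (Fin p) ℝ}
    (hH : H.PosDef) {K : Set (Dynamic p)} {γ : Static p}
    (hK : ∀ κ ∈ K, IsAdmissible i c A B β γ κ) (x : ℕ → Vec p) (T : ℕ) :
    ContinuousOn (quasiLik i H x T γ) K := by
  refine continuousOn_const.mul (continuousOn_finsetSum _ fun t ht => ?_)
  obtain ⟨s, rfl⟩ := Nat.exists_eq_add_of_le' (Finset.mem_Icc.1 ht).1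
  have hne : ∀ κ ∈ K, eigFilter i H x γ κ (s + 1) ≠ 0 := fun κ hκ =>
    (hc.trans_le ((hK κ hκ).le_eigFilter hc.le hH x s).2).ne'
  have hcont := (continuous_eigFilter i H x γ (s + 1)).continuousOn (s := K)
  exact (hcont.log hne).add (continuousOn_const.div hcont hne)

lemma eventually_isClose {γ : ℕ → Static p} {γ₀ : Static p} (hγ : Tendsto γ atTop (𝓝 γ₀))
    {δ : ℝ} (hδ : 0 < δ) : ∀ᶠ T in atTop, (∀ j, |(γ T).1 j - γ₀.1 j| ≤ δ) ∧
      ∀ j k, |(γ T).2 j k - γ₀.2 j k| ≤ δ := by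
  have h1 : Tendsto (fun T => (γ T).1) atTop (𝓝 γ₀.1) := (continuous_fst.tendsto _).comp hγ
  have h2 : Tendsto (fun T => (γ T).2) atTop (𝓝 γ₀.2) := (continuous_snd.tendsto _).comp hγ
  refine (eventually_all.2 fun j => ?_).and (eventually_all.2 fun j => eventually_all.2 fun k => ?_)
  · filter_upwards [(tendsto_pi_nhds.1 h1 j).eventually (Metric.ball_mem_nhds _ hδ)] with T hT
    exact le_of_lt hT
  · filter_upwards [(((continuous_id.matrix_elem j k).tendsto _).comp h2).eventually
      (Metric.ball_mem_nhds _ hδ)] with T hT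
    exact le_of_lt hT

/-- A sequence that stays in a compact set, and away from every point of it but one, converges. -/
lemma tendsto_of_eventually_notMem {E : Type*} [TopologicalSpace E] {K : Set E}
    (hK : IsCompact K) {x : ℕ → E} {y : E} (hx : ∀ n, x n ∈ K) {D : Set E} {U : E → Set E}
    (hU : ∀ z ∈ D, IsOpen (U z)) (hcover : K \ {y} ⊆ ⋃ z ∈ D, U z)
    (haway : ∀ z ∈ D, ∀ᶠ n in atTop, x n ∉ U z) : Tendsto x atTop (𝓝 y) := by
  refine hK.tendsto_nhds_of_unique_mapClusterPt (Eventually.of_forall hx) fun z hz hclus => ?_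
  by_contra hne
  obtain ⟨w, hw, hzw⟩ := Set.mem_iUnion₂.1 (hcover ⟨hz, hne⟩)
  obtain ⟨n, hn1, hn2⟩ := ((hclus.frequently ((hU w hw).mem_nhds hzw)).and_eventually
    (haway w hw)).exists
  exact hn2 hn1

end Estimator

/-! ### Almost sure limits along the sample. -/

section Consistency

variable {p : ℕ} {Ω : Type*} [mΩ : MeasurableSpace Ω] {P : Measure Ω}
  {X : ℤ → Ω → Vec p} {i : Fin p}

lemma integrable_sqSize (hX : ∀ t, Measurable (X t))
    (hmom : ∀ t j, MemLp (fun ω => X t ω j) 2 P) :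
    Integrable (fun x => sqSize (x 0)) (P.map (pathOf X)) := by
  have hm : Measurable fun x : ℤ → Vec p => sqSize (x 0) :=
    measurable_sqSize.comp (measurable_pi_apply 0)
  rw [integrable_map_measure hm.aestronglyMeasurable (measurable_pathOf hX).aemeasurable]
  have h : MemLp (fun ω => ∑ k, |X 0 ω k|) 2 P :=
    memLp_finsetSum _ fun k _ => (hmom 0 k).abs
  exact h.integrable_sq

variable [IsProbabilityMeasure P]

lemma ae_tendsto_sampleCov (hX : ∀ t, Measurable (X t)) (hse : IsStationaryErgodic P X)
    (hmom : ∀ t j, MemLp (fun ω => X t ω j) 2 P) :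
    ∀ᵐ ω ∂P, Tendsto (fun T => sampleCov X T ω) atTop (𝓝 (uncondCov P X)) := by
  have hpath := measurable_pathOf hX
  have : IsProbabilityMeasure (P.map (pathOf X)) :=
    Measure.isProbabilityMeasure_map hpath.aemeasurable
  have hent : ∀ j k, ∀ᵐ ω ∂P, Tendsto (fun T => sampleCov X T ω j k) atTop
      (𝓝 (uncondCov P X j k)) := fun j k => by
    have hm : Measurable fun x : ℤ → Vec p => x 0 j * x 0 k := by fun_prop
    have hi : Integrable (fun x : ℤ → Vec p => x 0 j * x 0 k) (P.map (pathOf X)) := by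
      rw [integrable_map_measure hm.aestronglyMeasurable hpath.aemeasurable]
      exact (hmom 0 j).integrable_mul (hmom 0 k)
    have hint : ∫ x, x 0 j * x 0 k ∂(P.map (pathOf X)) = uncondCov P X j k := by
      rw [integral_map hpath.aemeasurable hm.aestronglyMeasurable]
      rfl
    filter_upwards [ae_of_ae_map hpath.aemeasurable (ae_tendsto_average_shiftBy
      (ν := P.map (pathOf X)) hse hm hi)] with ω hω
    rw [hint] at hω
    refine hω.congr fun T => ?_
    simp [sampleCov, Matrix.sum_apply, Matrix.vecMulVec_apply, shiftBy, pathOf]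
  filter_upwards [ae_all_iff.2 fun j => ae_all_iff.2 (hent j)] with ω hω
  exact tendsto_pi_nhds.2 fun j => tendsto_pi_nhds.2 fun k => hω j k

/-- Near a parameter with larger expected quasi-likelihood, the quasi-likelihood eventually exceeds
its value at the true parameter. -/
lemma exists_ae_eventually_quasiLik_lt (hX : ∀ t, Measurable (X t))
    (hse : IsStationaryErgodic P X) (hN : Integrable (fun x => sqSize (x 0)) (P.map (pathOf X)))
    {c A B β r : ℝ} (hc : 0 < c) (hβ : β < 1) (hr : 0 < r) {K : Set (Dynamic p)} {γ₀ : Static p}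
    (hγ₀ : γ₀.2 ∈ Matrix.orthogonalGroup (Fin p) ℝ)
    (hadm : ∀ γ : Static p, γ.2 ∈ Matrix.orthogonalGroup (Fin p) ℝ →
      (∀ j, |γ.1 j - γ₀.1 j| ≤ r) → ∀ κ ∈ K, IsAdmissible i c A B β γ κ)
    {H : Matrix (Fin p) (Fin p) ℝ} (hH : H.PosDef) (x₀ : Ω → Vec p) {κ₀ κ₁ : Dynamic p}
    (hκ₀ : κ₀ ∈ K) (hκ₁ : κ₁ ∈ K)
    (hlt : ∫ x, lossPath i γ₀ κ₀ x ∂(P.map (pathOf X)) <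
      ∫ x, lossPath i γ₀ κ₁ x ∂(P.map (pathOf X))) :
    ∃ δ > 0, ∀ᵐ ω ∂P, ∀ γ : ℕ → Static p,
      (∀ T, (γ T).2 ∈ Matrix.orthogonalGroup (Fin p) ℝ) → Tendsto γ atTop (𝓝 γ₀) →
      ∀ᶠ T in atTop, ∀ κ ∈ K, κ ∈ Metric.ball κ₁ δ →
        quasiLik i H (sample x₀ X ω) T (γ T) κ₀ < quasiLik i H (sample x₀ X ω) T (γ T) κ := by
  have hpath := measurable_pathOf hX
  have : IsProbabilityMeasure (P.map (pathOf X)) :=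
    Measure.isProbabilityMeasure_map hpath.aemeasurable
  have hγadm : ∀ κ ∈ K, IsAdmissible i c A B β γ₀ κ :=
    hadm γ₀ hγ₀ fun j => by rw [sub_self, abs_zero]; exact hr.le
  -- Errors below half of the gap at both parameters preserve the strict inequality.
  have hε := half_pos (sub_pos.2 hlt)
  obtain ⟨δ₀, hδ₀, h₀⟩ := exists_ae_eventually_abs_quasiLik_sub_lt (ν := P.map (pathOf X)) hse hN
    hc hβ (hγadm κ₀ hκ₀) hH hε
  obtain ⟨δ₁, hδ₁, h₁⟩ := exists_ae_eventually_abs_quasiLik_sub_lt (ν := P.map (pathOf X)) hse hN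
    hc hβ (hγadm κ₁ hκ₁) hH hε
  refine ⟨δ₁, hδ₁, ?_⟩
  filter_upwards [ae_of_ae_map hpath.aemeasurable h₀, ae_of_ae_map hpath.aemeasurable h₁]
    with ω hω₀ hω₁ γ hγ hlim
  filter_upwards [hω₀ (sample x₀ X ω) fun t => rfl, hω₁ (sample x₀ X ω) fun t => rfl,
    eventually_isClose hlim hδ₀, eventually_isClose hlim hδ₁, eventually_isClose hlim hr]
    with T hT₀ hT₁ hcl₀ hcl₁ hclr κ hκ hball
  have hdist : dist κ κ₁ < δ₁ := hball
  rw [Prod.dist_eq, max_lt_iff] at hdist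
  have h2 := hT₀ (γ T) κ₀ (hadm _ (hγ T) hclr.1 κ₀ hκ₀)
    ⟨hcl₀.1, hcl₀.2, fun j => by simpa using hδ₀.le, by simpa using hδ₀.le⟩
  have h3 := hT₁ (γ T) κ (hadm _ (hγ T) hclr.1 κ hκ)
    ⟨hcl₁.1, hcl₁.2, fun j => (dist_le_pi_dist κ.1 κ₁.1 j).trans hdist.1.le, hdist.2.le⟩
  rw [abs_lt] at h2 h3
  linarith

end Consistency

end LambdaGARCH

/-! ### Strong consistency of the two-step estimator. -/

open LambdaGARCH
theorem theorem1 {p : ℕ} {Ω : Type*} [mΩ : MeasurableSpace Ω]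
    (P : Measure Ω) [IsProbabilityMeasure P] (ℱ : Filtration ℤ mΩ)
    -- the model and its true parameters
    (l₀ : Vec p) (V₀ A₀ : Matrix (Fin p) (Fin p) ℝ) (b₀ : Vec p) (Z X lam : ℤ → Ω → Vec p)
    (hmodel : IsLambdaGARCH P ℱ l₀ V₀ A₀ b₀ Z X lam)
    -- strict stationarity, ergodicity, finite second moments
    (hse : IsStationaryErgodic P X)
    (hmom : ∀ t j, MemLp (fun ω => X t ω j) 2 P)
    -- simple unconditional eigenvalues
    (hsimple : HasSimpleEigenvalues (uncondCov P X))
    -- normalization of the true static parameters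
    (S : Fin p → Set (Vec p)) (hS : ∀ j, IsSignRule (S j))
    (hl₀ : Monotone l₀) (hV₀ : ∀ j, V₀ᵀ j ∈ interior (S j))
    -- the equation, its parameter space, and identification
    (i : Fin p) (L : Set (Vec p)) (V : Set (Matrix (Fin p) (Fin p) ℝ)) (K : Set (Dynamic p))
    (hΘ : IsParameterSpace i L V K)
    (hθ₀ : (l₀, V₀, (A₀ i, b₀ i)) ∈ L ×ˢ V ×ˢ K)
    (hident : ∀ κ ∈ K, κ ≠ (A₀ i, b₀ i) → ∀ t : ℤ,
      ¬ (eigInf X i (l₀, V₀) κ t =ᵐ[P] eigInf X i (l₀, V₀) (A₀ i, b₀ i) t))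
    -- initial values of the likelihood recursion
    (x₀ : Ω → Vec p) (H₀ : Matrix (Fin p) (Fin p) ℝ) (hH₀ : H₀.PosDef)
    -- the two-step estimator
    (lHat : ℕ → Ω → Vec p) (VHat : ℕ → Ω → Matrix (Fin p) (Fin p) ℝ) (κHat : ℕ → Ω → Dynamic p)
    (hfirst : ∀ T ω, IsSpectralDecomp S (sampleCov X T ω) (lHat T ω, VHat T ω))
    (hsecond : ∀ T ω, IsArgmin K (quasiLik i H₀ (sample x₀ X ω) T (lHat T ω, VHat T ω))
      (κHat T ω)) :
    ∀ᵐ ω ∂P, Tendsto (fun T => (lHat T ω, VHat T ω, κHat T ω)) atTop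
      (𝓝 (l₀, V₀, (A₀ i, b₀ i))) := by
  obtain ⟨⟨hl₀L, -, hκ₀⟩, hX, horth⟩ : (l₀ ∈ L ∧ V₀ ∈ V ∧ (A₀ i, b₀ i) ∈ K) ∧
      (∀ t, Measurable (X t)) ∧ V₀ ∈ Matrix.orthogonalGroup (Fin p) ℝ :=
    ⟨hθ₀, hmodel.X_measurable, hmodel.orthogonal⟩
  have hK : IsCompact K := by
    have h := hΘ.isCompact.image (continuous_snd.comp continuous_snd)
    rwa [Set.image_comp, Set.snd_image_prod ⟨l₀, hl₀L⟩, Set.snd_image_prod ⟨V₀, hθ₀.2.1⟩] at h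
  have hN := integrable_sqSize hX hmom
  obtain ⟨c, A, B, β, r, hc, hβ, hr, hadm⟩ := exists_isAdmissible hΘ hK ⟨_, hκ₀⟩ hl₀L
  have hadm₀ : ∀ κ ∈ K, IsAdmissible i c A B β (l₀, V₀) κ :=
    hadm (l₀, V₀) horth fun j => by simpa using hr.le
  have hcov := hmodel.uncondCov_eq hse hmom
  have hstrict : StrictMono l₀ := hl₀.strictMono_of_injective
    (injective_of_hasSimpleEigenvalues horth (hcov ▸ hsimple))
  have hsep : ∀ κ ∈ K \ {(A₀ i, b₀ i)}, ∃ δ > 0, ∀ᵐ ω ∂P, ∀ γ : ℕ → Static p,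
      (∀ T, (γ T).2 ∈ Matrix.orthogonalGroup (Fin p) ℝ) → Tendsto γ atTop (𝓝 (l₀, V₀)) →
      ∀ᶠ T in atTop, ∀ κ' ∈ K, κ' ∈ Metric.ball κ δ →
        quasiLik i H₀ (sample x₀ X ω) T (γ T) (A₀ i, b₀ i) <
          quasiLik i H₀ (sample x₀ X ω) T (γ T) κ' := fun κ hκ =>
    exists_ae_eventually_quasiLik_lt hX hse hN hc hβ hr horth hadm hH₀ x₀ hκ₀ hκ.1
      (hmodel.integral_lossPath_lt hse hmom hN hc hβ (hadm₀ _ hκ₀) (hadm₀ κ hκ.1)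
        (hident κ hκ.1 hκ.2 0))
  choose! δ hδ hlt using hsep
  -- The set is not compact, as a point is removed; a countable subcover suffices to collect the
  -- exceptional null sets into one.
  obtain ⟨D, hDsub, hDcount, hDcover⟩ := TopologicalSpace.countable_cover_nhdsWithin
    (s := K \ {(A₀ i, b₀ i)}) (f := fun κ => Metric.ball κ (δ κ)) fun κ hκ =>
      mem_nhdsWithin_of_mem_nhds (Metric.ball_mem_nhds κ (hδ κ hκ))
  filter_upwards [ae_tendsto_sampleCov hX hse hmom,
    (ae_ball_iff hDcount).2 fun κ hκ => hlt κ (hDsub hκ)] with ω hω₁ hω₂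
  rw [hcov] at hω₁
  have hγ : Tendsto (fun T => (lHat T ω, VHat T ω)) atTop (𝓝 (l₀, V₀)) :=
    tendsto_of_isSpectralDecomp hS horth hstrict hV₀ hω₁ fun T => hfirst T ω
  have horthHat : ∀ T, VHat T ω ∈ Matrix.orthogonalGroup (Fin p) ℝ := fun T =>
    (hfirst T ω).orthogonal
  -- The first-step estimate need not lie in the parameter space, but once it is close to the truth
  -- the criterion is continuous on `K` and a minimizer exists.
  have hmin : ∀ᶠ T in atTop,
      IsMinOn (quasiLik i H₀ (sample x₀ X ω) T (lHat T ω, VHat T ω)) K (κHat T ω) := by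
    filter_upwards [eventually_isClose hγ hr] with T hT
    exact (hsecond T ω).2 (hK.exists_isMinOn ⟨_, hκ₀⟩ (continuousOn_quasiLik hc hH₀
      (hadm (lHat T ω, VHat T ω) (horthHat T) hT.1) _ T))
  have hκ : Tendsto (fun T => κHat T ω) atTop (𝓝 (A₀ i, b₀ i)) := by
    refine tendsto_of_eventually_notMem hK (fun T => (hsecond T ω).1)
      (fun κ _ => Metric.isOpen_ball) hDcover fun κ hκ => ?_
    filter_upwards [hmin, hω₂ κ hκ _ horthHat hγ] with T hT₁ hT₂ hmem
    exact absurd (hT₁ hκ₀) (not_le.2 (hT₂ _ (hsecond T ω).1 hmem))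
  have hl := (continuous_fst.tendsto (l₀, V₀)).comp hγ
  have hV := (continuous_snd.tendsto (l₀, V₀)).comp hγ
  exact hl.prodMk_nhds (hV.prodMk_nhds hκ)
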